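/- All graphs are finite and simple. For a graph $G$ and a set $S\subseteq V(G)$ let $\omega(G-S)$ be the number of connected components of $G-S$; $S$ is a cutset if $\omega(G-S)>1$. For a real number $t$, $G$ is $t$-tough if $|S|\ge t\cdot\omega(G-S)$ for every cutset $S$; the toughness $\tau(G)$ is the largest $t$ for which $G$ is $t$-tough, with $\tau(G)=\infty$ if $G$ is complete. $G$ is minimally $t$-tough if $\tau(G)=t$ and $\tau(G-e)<t$ for every edge $e$ of $G$. A graph is chordal if it has no induced cycle of length at least $4$. A TT-graph is a tree, or a graph obtained as follows. Take a tree $T$ of maximum degree $\Delta\ge 3$ and an independent set $Y$ of vertices of $T$ such that either (a) $\Delta=3$, $Y$ is the set of all vertices of degree $3$, and every neighbour of a vertex of $Y$ has degree $2$; or (b) $Y$ is a (possibly empty) set of vertices of degree $3$, and every neighbour of a vertex of $Y$ has degree $\Delta$. Remove all vertices of $Y$ and, for each removed vertex, join its three neighbours by a triangle. Let $\mu(G)$ be the maximum modified degree of $G$, i.e. the maximum over the vertices $v$ of the number of components of $G-v$. **Theorem.** For every positive rational number $t\le 1/2$, a chordal graph $G$ is minimally $t$-tough if and only if it is a TT-graph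 with toughness $\tau(G)=t=1/\mu(G)$. -/

import Mathlib

open SimpleGraph

universe u

namespace ToughChordal

/-- `ω(G - S)`: the number of connected components of the graph obtained from `G` by deleting
the vertices of `S`. -/
noncomputable def numComponents {V : Type u} (G : SimpleGraph V) (S : Set V) : ℕ :=
  Nat.card (G.induce Sᶜ).ConnectedComponent

/-- A cutset is a vertex set whose deletion leaves more than one component
(for a disconnected graph the empty set is a cutset). -/
def IsCutset {V : Type u} (G : SimpleGraph V) (S : Set V) : Prop :=
  1 < numComponents G S

/-- `G` is `t`-tough if `|S| ≥ t · ω(G - S)` for every cutset `S`. -/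
def IsTough {V : Type u} (G : SimpleGraph V) (t : ℝ) : Prop :=
  ∀ S : Set V, IsCutset G S → t * (numComponents G S : ℝ) ≤ (S.ncard : ℝ)

/-- The toughness `τ(G)`: the largest `t` for which `G` is `t`-tough; it is `⊤` for complete
graphs, which have no cutsets. -/
noncomputable def toughness {V : Type u} (G : SimpleGraph V) : EReal :=
  ⨆ (t : ℝ) (_ : IsTough G t), (t : EReal)

/-- `G` is minimally `t`-tough if `τ(G) = t` and `τ(G - e) < t` for every edge `e`. -/
def IsMinimallyTough {V : Type u} (G : SimpleGraph V) (t : ℝ) : Prop :=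
  toughness G = (t : EReal) ∧
    ∀ e ∈ G.edgeSet, toughness (G.deleteEdges {e}) < (t : EReal)

/-- A graph is chordal if it has no induced cycle of length at least `4`. -/
def IsChordal {V : Type u} (G : SimpleGraph V) : Prop :=
  ∀ n : ℕ, 4 ≤ n → IsEmpty (cycleGraph n ↪g G)

/-- The graph obtained from `T` by removing all vertices of `Y` in one step and making the
neighbours of each removed vertex pairwise adjacent. -/
def replaceByCliques {W : Type u} (T : SimpleGraph W) (Y : Set W) :
    SimpleGraph {w : W // w ∉ Y} where
  Adj a b := a ≠ b ∧ (T.Adj a b ∨ ∃ y ∈ Y, T.Adj y a ∧ T.Adj y b)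
  symm := ⟨fun _ _ h => ⟨h.1.symm, h.2.imp (fun h' => h'.symm)
    (fun ⟨y, hy, ha, hb⟩ => ⟨y, hy, hb, ha⟩)⟩⟩
  loopless := ⟨fun _ h => h.1 rfl⟩

/-- The sets `Y` of vertices of a tree `T` that may be replaced by triangles. -/
def IsReplaceable {W : Type u} [Fintype W] (T : SimpleGraph W) [DecidableRel T.Adj]
    (Y : Set W) : Prop :=
  T.IsIndepSet Y ∧
    ((T.maxDegree = 3 ∧ Y = {y | T.degree y = 3} ∧
        ∀ y ∈ Y, ∀ x, T.Adj y x → T.degree x = 2) ∨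
      (3 ≤ T.maxDegree ∧ (∀ y ∈ Y, T.degree y = 3) ∧
        ∀ y ∈ Y, ∀ x, T.Adj y x → T.degree x = T.maxDegree))

/-- TT-graphs: trees, and graphs obtained from a finite tree of maximum degree at least `3` by
replacing the vertices of a suitable set of degree-`3` vertices by triangles. -/
def IsTTGraph {V : Type u} (G : SimpleGraph V) : Prop :=
  G.IsTree ∨
    ∃ (W : Type u) (_ : Fintype W) (T : SimpleGraph W) (_ : DecidableRel T.Adj) (Y : Set W),
      T.IsTree ∧ 3 ≤ T.maxDegree ∧ IsReplaceable T Y ∧ Nonempty (G ≃g replaceByCliques T Y)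

/-- The modified degree of `v`: the number of components of `G - v`. -/
noncomputable def modifiedDegree {V : Type u} (G : SimpleGraph V) (v : V) : ℕ :=
  numComponents G {v}

/-- `μ(G)`: the maximum modified degree of `G`. -/
noncomputable def maxModifiedDegree {V : Type u} [Fintype V] (G : SimpleGraph V) : ℕ :=
  Finset.univ.sup (modifiedDegree G)

end ToughChordal

/-!
A critical set for an edge `xz` of a minimally `t`-tough graph `G` is a set `S` avoiding `x` and `z`
such that `xz` is a bridge of `G - S` and `|S| < t (ω(G - S) + 1)`. Every edge has one
(`exists_isCriticalFor`). As `t ≤ 1 / 2`, toughness gives `t ω(G - S) ≤ |S|` for every nonempty `S`,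
so a critical set is not a disjoint union of two nonempty sets `S₁`, `S₂` with
`ω(G - S) + 1 ≤ ω(G - S₁) + ω(G - S₂)`; this inequality holds if at most one component of `G - S`
is adjacent to both `S₁` and `S₂` (`numComponents_union_add_one_le`).

In a chordal graph `G` this forces every block to be an edge or a triangle. By Dirac's theorem
(`IsChordal.exists_simplicial`) a block with at least three vertices has a simplicial vertex `c`.
For two of its neighbours `x`, `z` in the block, a critical set contains `c` but no vertex of
the component of `G - c` containing `xz`, so `xz` is a bridge of `G - c` and the block is the
triangle `cxz` (`eq_or_adj_of_linked`). When all blocks are cliques, deleting a further vertex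
creates at most `μ - 1` new components, whence `ω(G - S) ≤ 1 + (μ - 1) |S|`. Therefore `t = 1 / μ`,
and a critical set is empty or a single vertex of modified degree `μ`
(`IsMinimallyTough.isTriangleTree`). Replacing the triangles of `G` by stars yields a tree in which
an original vertex has its modified degree as degree (`starTree`, `IsTriangleTree.degree_inl`),
so `G` is a TT-graph.

Conversely, in a TT-graph of toughness `1 / μ` an edge in no triangle is a bridge, and deleting it
brings the toughness down to `0`. If `ab` is an edge of a triangle `abc`, the modified degree of `c`
is `μ`, and `G - ab - c` has at least `μ + 1` components (`IsReplacement.degree_add_one_le`).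
-/

namespace ToughChordal

/-! ### Components after the deletion of a vertex set -/

section Linked

variable {V : Type u} {G H : SimpleGraph V} {S S' : Set V} {a b c : V}

/-- `Linked G S a b`: the vertices `a` and `b` are joined by a walk of `G - S`. The empty walk is
allowed even at a vertex of `S`, which is harmless as the relation is only used outside `S`. -/
def Linked (G : SimpleGraph V) (S : Set V) : V → V → Prop :=
  Relation.ReflTransGen fun x y => G.Adj x y ∧ x ∉ S ∧ y ∉ S

lemma Linked.refl (G : SimpleGraph V) (S : Set V) (a : V) : Linked G S a a :=
  Relation.ReflTransGen.refl

lemma Linked.trans (h : Linked G S a b) (h' : Linked G S b c) : Linked G S a c :=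
  Relation.ReflTransGen.trans h h'

lemma Linked.of_eq (h : a = b) : Linked G S a b := h ▸ Linked.refl G S a

lemma Linked.of_adj (h : G.Adj a b) (ha : a ∉ S) (hb : b ∉ S) : Linked G S a b :=
  Relation.ReflTransGen.single ⟨h, ha, hb⟩

lemma Linked.symm (h : Linked G S a b) : Linked G S b a := by
  induction h with
  | refl => exact .refl ..
  | tail _ h ih => exact (Linked.of_adj h.1.symm h.2.2 h.2.1).trans ih

lemma Linked.mono (hG : G ≤ H) (hS : S' ⊆ S) (h : Linked G S a b) : Linked H S' a b :=
  Relation.ReflTransGen.mono (fun _ _ h => ⟨hG h.1, fun h' => h.2.1 (hS h'),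
    fun h' => h.2.2 (hS h')⟩) _ _ h

/-- A set closed under the steps of `G - S` contains everything linked to one of its members. -/
lemma Linked.mem_of_closed {P : V → Prop} (h : Linked G S a b) (ha : P a)
    (hP : ∀ x y, P x → G.Adj x y → x ∉ S → y ∉ S → P y) : P b := by
  induction h with
  | refl => exact ha
  | tail _ h ih => exact hP _ _ ih h.1 h.2.1 h.2.2

lemma Linked.notMem (h : Linked G S a b) (ha : a ∉ S) : b ∉ S :=
  h.mem_of_closed (P := fun x => x ∉ S) ha fun _ _ _ _ _ h => h

/-- A walk of `G - S` from `a` to `c ≠ a`, cut just before its first visit to `c`. -/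
lemma Linked.exists_adj (h : Linked G S a c) (hac : a ≠ c) :
    ∃ q, G.Adj q c ∧ q ∉ S ∧ Linked G (insert c S) a q := by
  induction h using Relation.ReflTransGen.head_induction_on with
  | refl => exact absurd rfl hac
  | @head x y hxy hyc ih =>
    by_cases hy : y = c
    · subst hy
      exact ⟨x, hxy.1, hxy.2.1, .refl ..⟩
    · obtain ⟨q, hq, hqS, hl⟩ := ih hy
      refine ⟨q, hq, hqS, (Linked.of_adj hxy.1 ?_ ?_).trans hl⟩
      · simp [hac, hxy.2.1]
      · simp [hy, hxy.2.2]

lemma reachable_induce_iff (a b : (Sᶜ : Set V)) :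
    (G.induce Sᶜ).Reachable a b ↔ Linked G S a b := by
  rw [reachable_iff_reflTransGen]
  constructor
  · intro h
    induction h with
    | refl => exact .refl ..
    | @tail x y _ h ih => exact ih.trans (.of_adj h x.2 y.2)
  · intro h
    have key : ∀ c, Linked G S a c → ∀ hc : c ∈ Sᶜ,
        Relation.ReflTransGen (G.induce Sᶜ).Adj a ⟨c, hc⟩ := by
      intro c hl
      induction hl with
      | refl => exact fun _ => .refl
      | @tail x y _ h ih => exact fun hc => (ih h.2.1).tail h.1
    exact key b h b.2

lemma reachable_iff_linked_empty : G.Reachable a b ↔ Linked G ∅ a b := by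
  rw [reachable_iff_reflTransGen]
  simp [Linked]

/-- `A` is a set of vertices outside `S` lying in pairwise different components of `G - S`. -/
def Separated (G : SimpleGraph V) (S : Set V) (A : Finset V) : Prop :=
  (∀ a ∈ A, a ∉ S) ∧ ∀ a ∈ A, ∀ b ∈ A, Linked G S a b → a = b

lemma Separated.subset {A B : Finset V} (h : Separated G S A) (hB : B ⊆ A) : Separated G S B :=
  ⟨fun a ha => h.1 a (hB ha), fun a ha b hb => h.2 a (hB ha) b (hB hb)⟩

lemma Separated.card_le [Finite V] {A : Finset V} (h : Separated G S A) :
    A.card ≤ numComponents G S := by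
  classical
  have := Nat.card_le_card_of_injective
    (fun a : A => (G.induce Sᶜ).connectedComponentMk ⟨a, h.1 a a.2⟩) (by
      intro a b hab
      have := (reachable_induce_iff _ _).1 (ConnectedComponent.exact hab)
      exact Subtype.ext (h.2 a a.2 b b.2 this))
  simpa [numComponents] using this

lemma exists_separated [Finite V] (G : SimpleGraph V) (S : Set V) :
    ∃ A : Finset V, Separated G S A ∧ A.card = numComponents G S := by
  classical
  have := Fintype.ofFinite V
  have := Fintype.ofFinite (G.induce Sᶜ).ConnectedComponent
  have hout (C : (G.induce Sᶜ).ConnectedComponent) :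
      (G.induce Sᶜ).connectedComponentMk C.out = C := Quot.out_eq C
  let f : (G.induce Sᶜ).ConnectedComponent → V := fun C => C.out
  have hf : ∀ C C', Linked G S (f C) (f C') → C = C' := fun C C' h => by
    rw [← hout C, ← hout C']
    exact ConnectedComponent.sound ((reachable_induce_iff _ _).2 h)
  refine ⟨Finset.univ.image f, ⟨?_, ?_⟩, ?_⟩
  · simp only [Finset.mem_image, Finset.mem_univ, true_and, forall_exists_index,
      forall_apply_eq_imp_iff]
    exact fun C => C.out.2
  · simp only [Finset.mem_image, Finset.mem_univ, true_and, forall_exists_index,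
      forall_apply_eq_imp_iff]
    exact fun C C' h => congrArg f (hf C C' h)
  · rw [Finset.card_image_of_injective _ (fun C C' h => hf C C' (.of_eq h)),
      numComponents, Nat.card_eq_fintype_card, Finset.card_univ]

/-- A family version of `Separated.card_le`. -/
lemma card_le_numComponents [Finite V] {ι : Type*} [Fintype ι] (f : ι → V)
    (hf : ∀ i, f i ∉ S) (hinj : ∀ i j, Linked G S (f i) (f j) → i = j) :
    Fintype.card ι ≤ numComponents G S := by
  classical
  have h : Separated G S (Finset.univ.image f) := by
    refine ⟨?_, ?_⟩
    · simpa using hf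
    · simp only [Finset.mem_image, Finset.mem_univ, true_and, forall_exists_index,
        forall_apply_eq_imp_iff]
      exact fun i j h => congrArg f (hinj i j h)
  have := h.card_le
  rwa [Finset.card_image_of_injective _ (fun i j h => hinj i j (.of_eq h)),
    Finset.card_univ] at this

/-- Components of `G - (S ∪ U)` without a neighbour in `U` are components of `G - S`, and a
vertex of `U \ S` lies in yet another component of `G - S`. -/
lemma Separated.insert_of_no_neighbor [DecidableEq V] {U : Set V} {A : Finset V} {u : V}
    (hA : Separated G (S ∪ U) A) (hu : u ∈ U) (huS : u ∉ S)
    (h : ∀ a ∈ A, ∀ q, Linked G (S ∪ U) a q → ∀ w ∈ U, ¬ G.Adj q w) :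
    Separated G S (insert u A) ∧ (insert u A).card = A.card + 1 := by
  have hclosed : ∀ a ∈ A, ∀ b, Linked G S a b → Linked G (S ∪ U) a b := by
    intro a ha b hb
    refine hb.mem_of_closed (P := fun x => Linked G (S ∪ U) a x) (.refl ..) ?_
    intro x y hx hxy hxS hyS
    refine hx.trans (.of_adj hxy (hx.notMem (hA.1 a ha)) ?_)
    rintro (hy | hy)
    · exact hyS hy
    · exact h a ha x hx y hy hxy
  have hno : ∀ a ∈ A, ¬ Linked G S a u := fun a ha hl =>
    (hclosed a ha u hl).notMem (hA.1 a ha) (Or.inr hu)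
  refine ⟨⟨?_, ?_⟩, Finset.card_insert_of_notMem fun hu' => hA.1 u hu' (Or.inr hu)⟩
  · intro a ha
    rcases Finset.mem_insert.1 ha with rfl | ha
    · exact huS
    · exact fun h' => hA.1 a ha (Or.inl h')
  · intro a ha b hb hl
    rcases Finset.mem_insert.1 ha with rfl | ha' <;> rcases Finset.mem_insert.1 hb with rfl | hb'
    · rfl
    · exact absurd hl.symm (hno b hb')
    · exact absurd hl (hno a ha')
    · exact hA.2 a ha' b hb' (hclosed a ha' b hl)

/-- If at most one component of `G - (S ∪ U)` has neighbours both in `S` and in `U`, then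
deleting `S` and `U` separately costs at least one component more than deleting them together. -/
lemma numComponents_union_add_one_le [Finite V] {U : Set V} (hSU : Disjoint S U)
    (hS : S.Nonempty) (hU : U.Nonempty) {k : V}
    (h : ∀ p q, Linked G (S ∪ U) p q → p ∉ S ∪ U → (∃ s ∈ S, G.Adj p s) → (∃ w ∈ U, G.Adj q w) →
      Linked G (S ∪ U) p k) :
    numComponents G (S ∪ U) + 1 ≤ numComponents G S + numComponents G U := by
  classical
  obtain ⟨A, hA, hcard⟩ := exists_separated G (S ∪ U)
  obtain ⟨s, hs⟩ := hS
  obtain ⟨w, hw⟩ := hU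
  let A₁ := A.filter fun a => ∀ q, Linked G (S ∪ U) a q → ∀ w ∈ U, ¬ G.Adj q w
  let A₂ := A.filter fun a => ∀ q, Linked G (S ∪ U) a q → ∀ w ∈ S, ¬ G.Adj q w
  let A₃ := A.filter fun a => Linked G (S ∪ U) a k
  have hcov : A ⊆ (A₁ ∪ A₂) ∪ A₃ := by
    intro a ha
    by_contra hn
    simp only [A₁, A₂, A₃, Finset.mem_union, Finset.mem_filter, ha, true_and, not_or] at hn
    obtain ⟨⟨h1, h2⟩, h3⟩ := hn
    push Not at h1 h2
    obtain ⟨q, hq, w', hw', hqw⟩ := h1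
    obtain ⟨p, hp, s', hs', hps⟩ := h2
    exact h3 (hp.trans (h p q (hp.symm.trans hq) (hp.notMem (hA.1 a ha)) ⟨s', hs', hps⟩
      ⟨w', hw', hqw⟩))
  have h3 : A₃.card ≤ 1 := Finset.card_le_one.2 fun a ha b hb => by
    simp only [A₃, Finset.mem_filter] at ha hb
    exact hA.2 a ha.1 b hb.1 (ha.2.trans hb.2.symm)
  have h1 := (hA.subset (Finset.filter_subset _ _) : Separated G (S ∪ U) A₁).insert_of_no_neighbor
    hw (fun h' => hSU.le_bot ⟨h', hw⟩) (fun a ha => (Finset.mem_filter.1 ha).2)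
  have h2 : Separated G (U ∪ S) A₂ := by
    rw [Set.union_comm]; exact hA.subset (Finset.filter_subset _ _)
  have h2 := h2.insert_of_no_neighbor hs (fun h' => hSU.le_bot ⟨hs, h'⟩) (fun a ha => by
    rw [Set.union_comm]; exact (Finset.mem_filter.1 ha).2)
  have := h1.1.card_le
  have := h2.1.card_le
  have := Finset.card_le_card hcov
  have := Finset.card_union_le (A₁ ∪ A₂) A₃
  have := Finset.card_union_le A₁ A₂
  omega

/-- If neighbours of `s` in a common component of `G - s` are adjacent, then deleting `s` after
`S` creates no more new components than deleting `s` from `G`. -/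
lemma numComponents_insert_add_one_le [Finite V] {s : V} (hs : s ∉ S)
    (h : ∀ a b, G.Adj s a → G.Adj s b → Linked G {s} a b → a = b ∨ G.Adj a b) :
    numComponents G (S ∪ {s}) + 1 ≤ numComponents G S + numComponents G {s} := by
  classical
  obtain ⟨A, hA, hcard⟩ := exists_separated G (S ∪ {s})
  let A₁ := A.filter fun a => ∀ q, Linked G (S ∪ {s}) a q → ∀ w ∈ ({s} : Set V), ¬ G.Adj q w
  let A₂ := A.filter fun a => ¬ ∀ q, Linked G (S ∪ {s}) a q → ∀ w ∈ ({s} : Set V), ¬ G.Adj q w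
  have hsum : A₁.card + A₂.card = A.card := Finset.card_filter_add_card_filter_not _
  have h1 := (hA.subset (Finset.filter_subset _ _) :
    Separated G (S ∪ {s}) A₁).insert_of_no_neighbor (u := s) rfl hs
      (fun a ha => (Finset.mem_filter.1 ha).2)
  have hex : ∀ a : A₂, ∃ q, Linked G (S ∪ {s}) a q ∧ G.Adj s q := by
    rintro ⟨a, ha⟩
    have := (Finset.mem_filter.1 ha).2
    push Not at this
    obtain ⟨q, hq, w, rfl, hw⟩ := this
    exact ⟨q, hq, hw.symm⟩
  choose f hf hfs using hex
  have h2 : Fintype.card A₂ ≤ numComponents G {s} := by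
    refine card_le_numComponents f (fun i => (hfs i).ne') fun i j hij => ?_
    have hi := hA.1 i (Finset.mem_filter.1 i.2).1
    have hj := hA.1 j (Finset.mem_filter.1 j.2).1
    have : Linked G (S ∪ {s}) (f i) (f j) := by
      rcases h _ _ (hfs i) (hfs j) hij with h' | h'
      · rw [h']; exact .refl ..
      · exact .of_adj h' ((hf i).notMem hi) ((hf j).notMem hj)
    exact Subtype.ext (hA.2 i (Finset.mem_filter.1 i.2).1 j (Finset.mem_filter.1 j.2).1
      (((hf i).trans this).trans (hf j).symm))
  rw [Fintype.card_coe] at h2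
  have := h1.1.card_le
  omega

/-- Deleting an edge creates at most one new component, and none if its ends stay linked. -/
lemma numComponents_deleteEdges [Finite V] {x z : V}
    (h : numComponents G S < numComponents (G.deleteEdges {s(x, z)}) S) :
    x ∉ S ∧ z ∉ S ∧ ¬ Linked (G.deleteEdges {s(x, z)}) S x z ∧
      numComponents (G.deleteEdges {s(x, z)}) S ≤ numComponents G S + 1 := by
  classical
  set H := G.deleteEdges {s(x, z)} with hH
  obtain ⟨A, hA, hcard⟩ := exists_separated H S
  have step : ∀ a b, Linked G S a b → Linked H S a b ∨
      (x ∉ S ∧ z ∉ S ∧ (Linked H S a x ∧ Linked H S z b ∨ Linked H S a z ∧ Linked H S x b)) := by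
    intro a b hab
    refine hab.mem_of_closed (P := fun b => Linked H S a b ∨ (x ∉ S ∧ z ∉ S ∧
      (Linked H S a x ∧ Linked H S z b ∨ Linked H S a z ∧ Linked H S x b))) (Or.inl (.refl ..)) ?_
    intro p q hp hpq hpS hqS
    by_cases he : s(p, q) = s(x, z)
    · rw [Sym2.eq_iff] at he
      rcases he with ⟨rfl, rfl⟩ | ⟨rfl, rfl⟩
      · rcases hp with hp | ⟨-, -, hp | hp⟩
        · exact Or.inr ⟨hpS, hqS, Or.inl ⟨hp, .refl ..⟩⟩
        · exact Or.inr ⟨hpS, hqS, Or.inl ⟨hp.1, .refl ..⟩⟩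
        · exact Or.inl hp.1
      · rcases hp with hp | ⟨-, -, hp | hp⟩
        · exact Or.inr ⟨hqS, hpS, Or.inr ⟨hp, .refl ..⟩⟩
        · exact Or.inl hp.1
        · exact Or.inr ⟨hqS, hpS, Or.inr ⟨hp.1, .refl ..⟩⟩
    · have hl : Linked H S p q := .of_adj (by simp [hH, hpq, he]) hpS hqS
      rcases hp with hp | ⟨h1, h2, hp | hp⟩
      · exact Or.inl (hp.trans hl)
      · exact Or.inr ⟨h1, h2, Or.inl ⟨hp.1, hp.2.trans hl⟩⟩
      · exact Or.inr ⟨h1, h2, Or.inr ⟨hp.1, hp.2.trans hl⟩⟩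
  have key : x ∉ S ∧ z ∉ S ∧ ¬ Linked H S x z := by
    by_contra hcon
    refine h.not_ge (hcard ▸ Separated.card_le ⟨hA.1, fun a ha b hb hl => hA.2 a ha b hb ?_⟩)
    rcases step a b hl with h' | ⟨h1, h2, h'⟩
    · exact h'
    · have hxz : Linked H S x z := by tauto
      rcases h' with h' | h'
      · exact (h'.1.trans hxz).trans h'.2
      · exact (h'.1.trans hxz.symm).trans h'.2
  refine ⟨key.1, key.2.1, key.2.2, ?_⟩
  let A₁ := A.filter fun a => ¬ Linked H S a x
  let A₂ := A.filter fun a => Linked H S a x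
  have hsum : A₂.card + A₁.card = A.card := Finset.card_filter_add_card_filter_not _
  have h2 : A₂.card ≤ 1 := Finset.card_le_one.2 fun a ha b hb => by
    simp only [A₂, Finset.mem_filter] at ha hb
    exact hA.2 a ha.1 b hb.1 (ha.2.trans hb.2.symm)
  have h1 : Separated G S A₁ := by
    refine ⟨fun a ha => hA.1 a (Finset.mem_filter.1 ha).1, fun a ha b hb hl => ?_⟩
    simp only [A₁, Finset.mem_filter] at ha hb
    rcases step a b hl with h' | ⟨-, -, h' | h'⟩
    · exact hA.2 a ha.1 b hb.1 h'
    · exact absurd h'.1 ha.2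
    · exact absurd h'.2.symm hb.2
  have := h1.card_le
  omega

end Linked

/-! ### Simplicial vertices of chordal graphs -/

section Chordal

variable {V : Type u} {G : SimpleGraph V}

lemma cycleGraph_adj_iff_val {m : ℕ} {u v : Fin (m + 2)} (h : u < v) :
    (cycleGraph (m + 2)).Adj u v ↔ v.val = u.val + 1 ∨ (u.val = 0 ∧ v.val = m + 1) := by
  have h' : u.val < v.val := h
  have := v.isLt
  rw [cycleGraph_adj', Fin.coe_sub_iff_le.2 h.le, Fin.coe_sub_iff_lt.2 h]
  omega

/-- A chordal graph has no induced cycle, here given as a sequence `f 0, …, f (m + 1)`. -/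
lemma IsChordal.false_of_cycle (hG : IsChordal G) {m : ℕ} (hm : 2 ≤ m) (f : ℕ → V)
    (hinj : ∀ i j, i < j → j ≤ m + 1 → f i ≠ f j)
    (hadj : ∀ i j, i < j → j ≤ m + 1 → (G.Adj (f i) (f j) ↔ j = i + 1 ∨ (i = 0 ∧ j = m + 1))) :
    False := by
  refine (hG (m + 2) (by omega)).false ⟨⟨fun i => f i, ?_⟩, ?_⟩
  · intro i j hij
    rcases lt_trichotomy i j with h | h | h
    · exact absurd hij (hinj _ _ h (by omega))
    · exact h
    · exact absurd hij.symm (hinj _ _ h (by omega))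
  · intro i j
    change G.Adj (f i) (f j) ↔ _
    rcases lt_trichotomy i j with h | rfl | h
    · rw [hadj _ _ h (by omega), cycleGraph_adj_iff_val h]
    · simp
    · rw [G.adj_comm, (cycleGraph _).adj_comm, hadj _ _ h (by omega),
        cycleGraph_adj_iff_val h]

/-- Two vertices `y`, `y'` outside a connected set `C`, both with neighbours in `C`, and with a
common neighbour `r` that lies outside `C` and has no neighbour in `C`, are adjacent:
otherwise a shortest walk from `y` to `y'` through `C` closes up with `r` to an induced cycle. -/
lemma IsChordal.adj_of_common_neighbor (hG : IsChordal G) {C : Set V}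
    (hC : ∀ a ∈ C, ∀ b ∈ C, Linked G Cᶜ a b) {y y' r a a' : V} (hne : y ≠ y')
    (ha : a ∈ C) (ha' : a' ∈ C) (hya : G.Adj y a) (hya' : G.Adj y' a')
    (hr : r ∉ C) (hrC : ∀ c ∈ C, ¬ G.Adj r c) (hry : G.Adj r y) (hry' : G.Adj r y') :
    G.Adj y y' := by
  by_contra hnadj
  let D : Set V := C ∪ {y, y'}
  have hyD : y ∈ D := by simp [D]
  have hyD' : y' ∈ D := by simp [D]
  have hlink : Linked G Dᶜ y y' := by
    have h1 : Linked G Dᶜ y a := .of_adj hya (by simp [hyD]) (by simp [D, ha])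
    have h2 : Linked G Dᶜ a' y' := .of_adj hya'.symm (by simp [D, ha']) (by simp [hyD'])
    exact (h1.trans ((hC a ha a' ha').mono le_rfl
      (Set.compl_subset_compl.2 Set.subset_union_left))).trans h2
  have hreach : (G.induce D).Reachable ⟨y, hyD⟩ ⟨y', hyD'⟩ := by
    have := (reachable_induce_iff (G := G) (S := Dᶜ) ⟨y, by simpa using hyD⟩
      ⟨y', by simpa using hyD'⟩).2 hlink
    let φ : G.induce Dᶜᶜ →g G.induce D := ⟨fun x => ⟨x.1, not_not.1 x.2⟩, fun h => h⟩
    exact Reachable.map φ this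
  obtain ⟨p, hp⟩ := hreach.exists_walk_length_eq_dist
  have hpath := p.isPath_of_length_eq_dist hp
  have hinj := hpath.getVert_injOn
  set m := p.length with hm
  have h0 : p.getVert 0 = ⟨y, hyD⟩ := p.getVert_zero
  have hlast : p.getVert m = ⟨y', hyD'⟩ := p.getVert_length
  have hm2 : 2 ≤ m := by
    by_contra hlt
    have : m = 0 ∨ m = 1 := by omega
    rcases this with h | h
    · rw [h, h0] at hlast
      exact hne (congrArg Subtype.val hlast)
    · have hadj := p.adj_getVert_succ (i := 0) (by omega)
      rw [zero_add, ← h, hlast, h0] at hadj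
      exact hnadj hadj
  have hshort : ∀ i j, i < j → j ≤ m → (G.induce D).Adj (p.getVert i) (p.getVert j) →
      j = i + 1 := by
    intro i j hij hj h
    have hlen := dist_le ((p.take i).append (.cons h (p.drop j)))
    rw [Walk.length_append, Walk.length_cons, Walk.take_length, Walk.drop_length, ← hp] at hlen
    omega
  have hrD : ∀ i ≤ m, (G.Adj (p.getVert i) r ↔ i = 0 ∨ i = m) := by
    intro i hi
    constructor
    · intro h
      rcases (p.getVert i).2 with hc | hc | hc
      · exact absurd h.symm (hrC _ hc)
      · exact Or.inl (hinj hi (Nat.zero_le m) (Subtype.ext (by rw [hc, h0])))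
      · exact Or.inr (hinj hi (le_refl m)
          (Subtype.ext (by rw [Set.mem_singleton_iff.1 hc, hlast])))
    · rintro (rfl | rfl)
      · rw [h0]; exact hry.symm
      · rw [hlast]; exact hry'.symm
  have hrne : ∀ i, (p.getVert i : V) ≠ r := by
    intro i h
    rcases (p.getVert i).2 with hc | hc | hc
    · exact hr (h ▸ hc)
    · exact hry.ne (h.symm.trans hc)
    · exact hry'.ne (h.symm.trans hc)
  refine hG.false_of_cycle hm2 (fun i => if i ≤ m then p.getVert i else r) ?_ ?_
  · intro i j hij hj
    have hi : i ≤ m := by omega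
    by_cases hjm : j ≤ m
    · simp only [hi, hjm, if_true]
      exact fun h => hij.ne (hinj hi hjm (Subtype.ext h))
    · simp only [hi, hjm, if_true, if_false]
      exact hrne i
  · intro i j hij hj
    have hi : i ≤ m := by omega
    by_cases hjm : j ≤ m
    · simp only [hi, hjm, if_true]
      constructor
      · exact fun h => Or.inl (hshort i j hij hjm h)
      · rintro (rfl | h)
        · exact p.adj_getVert_succ (by omega)
        · omega
    · simp only [hi, hjm, if_true, if_false]
      rw [hrD i hi]
      omega

/-- Dirac's theorem, relative to a vertex set: a nonempty set `R` of vertices of a chordal graph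
has a member whose neighbours in `R` are pairwise adjacent. If `R` is not a clique, take a
maximal connected `C ⊆ R` such that some vertex of `R` is neither in `C` nor adjacent to `C`;
by maximality these vertices are all adjacent to the whole of `N(C)`, which is a clique, so
a simplicial vertex among them is simplicial in `R`. -/
lemma IsChordal.exists_simplicial (hG : IsChordal G) (R : Finset V) (hR : R.Nonempty) :
    ∃ c ∈ R, ∀ x ∈ R, ∀ y ∈ R, G.Adj c x → G.Adj c y → x ≠ y → G.Adj x y := by
  classical
  induction R using Finset.strongInduction with
  | H R ih =>
  by_cases hclique : ∀ x ∈ R, ∀ y ∈ R, x ≠ y → G.Adj x y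
  · obtain ⟨c, hc⟩ := hR
    exact ⟨c, hc, fun x hx y hy _ _ h => hclique x hx y hy h⟩
  push Not at hclique
  obtain ⟨x₀, hx₀, y₀, hy₀, hne₀, hadj₀⟩ := hclique
  let good : Finset V → Prop := fun C => C.Nonempty ∧
    (∀ a ∈ C, ∀ b ∈ C, Linked G (C : Set V)ᶜ a b) ∧
    ∃ r ∈ R, r ∉ C ∧ ∀ c ∈ C, ¬ G.Adj r c
  have hgood₀ : {x₀} ∈ R.powerset.filter good := by
    simp only [Finset.mem_filter, Finset.mem_powerset, Finset.singleton_subset_iff, hx₀,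
      true_and, good]
    refine ⟨by simp, ?_, y₀, hy₀, by simpa using hne₀.symm, ?_⟩
    · simp only [Finset.mem_singleton]
      rintro a rfl b rfl
      exact .refl ..
    · simpa using fun h => hadj₀ h.symm
  obtain ⟨C, hCmem, hCmax⟩ := Finset.exists_max_image _ Finset.card ⟨_, hgood₀⟩
  obtain ⟨hCR, ⟨z, hz⟩, hCconn, r₀, hr₀, hr₀C, hr₀N⟩ :
      C ⊆ R ∧ good C := by simpa using hCmem
  let R' := R.filter fun r => r ∉ C ∧ ∀ c ∈ C, ¬ G.Adj r c
  have hR' : ∀ {r}, r ∈ R' ↔ r ∈ R ∧ r ∉ C ∧ ∀ c ∈ C, ¬ G.Adj r c := by simp [R']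
  -- by maximality of `C`, every vertex of `R` adjacent to `C` is adjacent to the whole of `R'`
  have hfull : ∀ y ∈ R, y ∉ C → (∃ a ∈ C, G.Adj y a) → ∀ r ∈ R', G.Adj r y := by
    rintro y hy hyC ⟨a, ha, hya⟩ r hr
    by_contra hadj
    obtain ⟨hrR, hrC, hrN⟩ := hR'.1 hr
    have hmem : insert y C ∈ R.powerset.filter good := by
      simp only [Finset.mem_filter, Finset.mem_powerset]
      refine ⟨Finset.insert_subset hy hCR, ⟨y, by simp⟩, ?_, r, hrR, ?_, ?_⟩
      · have hsub : ((insert y C : Finset V) : Set V)ᶜ ⊆ (C : Set V)ᶜ :=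
          Set.compl_subset_compl.2 (by simp)
        have hya' : Linked G ((insert y C : Finset V) : Set V)ᶜ y a :=
          .of_adj hya (by simp) (by simp [ha])
        have : ∀ b ∈ insert y C, Linked G ((insert y C : Finset V) : Set V)ᶜ a b := by
          intro b hb
          rcases Finset.mem_insert.1 hb with rfl | hb
          · exact hya'.symm
          · exact (hCconn a ha b hb).mono le_rfl hsub
        exact fun b hb c hc => (this b hb).symm.trans (this c hc)
      · rw [Finset.mem_insert, not_or]
        exact ⟨fun h => hrN a ha (h ▸ hya), hrC⟩
      · intro c hc
        rcases Finset.mem_insert.1 hc with rfl | hc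
        · exact hadj
        · exact hrN c hc
    have := hCmax _ hmem
    rw [Finset.card_insert_of_notMem hyC] at this
    omega
  obtain ⟨c, hc, hcs⟩ := ih R' (Finset.filter_ssubset.2 ⟨z, hCR hz, fun h => h.1 hz⟩)
    ⟨r₀, hR'.2 ⟨hr₀, hr₀C, hr₀N⟩⟩
  obtain ⟨hcR, hcC, hcN⟩ := hR'.1 hc
  refine ⟨c, hcR, ?_⟩
  have hnotC : ∀ x, G.Adj c x → x ∉ C := fun x hx h => hcN x h hx
  intro x hx y hy hcx hcy hxy
  by_cases hxR : x ∈ R' <;> by_cases hyR : y ∈ R'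
  · exact hcs x hxR y hyR hcx hcy hxy
  · have : ∃ a ∈ C, G.Adj y a := by
      by_contra h; push Not at h; exact hyR (hR'.2 ⟨hy, hnotC y hcy, h⟩)
    exact hfull y hy (hnotC y hcy) this x hxR
  · have : ∃ a ∈ C, G.Adj x a := by
      by_contra h; push Not at h; exact hxR (hR'.2 ⟨hx, hnotC x hcx, h⟩)
    exact (hfull x hx (hnotC x hcx) this y hyR).symm
  · obtain ⟨a, ha, hya⟩ : ∃ a ∈ C, G.Adj y a := by
      by_contra h; push Not at h; exact hyR (hR'.2 ⟨hy, hnotC y hcy, h⟩)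
    obtain ⟨b, hb, hxb⟩ : ∃ a ∈ C, G.Adj x a := by
      by_contra h; push Not at h; exact hxR (hR'.2 ⟨hx, hnotC x hcx, h⟩)
    exact hG.adj_of_common_neighbor (C := (C : Set V)) (by simpa using hCconn) hxy hb ha hxb hya
      (r := c) (by simpa using hcC) (by simpa using hcN) hcx hcy

end Chordal

/-! ### Toughness and critical sets -/

section Toughness

variable {V : Type u} {G : SimpleGraph V} {t : ℝ}

lemma IsTough.le_toughness (h : IsTough G t) : (t : EReal) ≤ toughness G :=
  le_iSup₂ (f := fun (t : ℝ) (_ : IsTough G t) => (t : EReal)) t h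

/-- The supremum defining a finite toughness is attained. -/
lemma isTough_of_toughness_eq (h : toughness G = (t : EReal)) : IsTough G t := by
  intro S hS
  have hpos : (0 : ℝ) < numComponents G S := by
    exact_mod_cast (lt_trans zero_lt_one hS)
  by_contra! hlt
  have h1 : ((S.ncard / numComponents G S : ℝ) : EReal) < toughness G := by
    rw [h, EReal.coe_lt_coe_iff, div_lt_iff₀ hpos]
    exact hlt
  obtain ⟨t', hlt'⟩ := lt_iSup_iff.1 h1
  obtain ⟨ht', hlt'⟩ := lt_iSup_iff.1 hlt'
  rw [EReal.coe_lt_coe_iff, div_lt_iff₀ hpos] at hlt'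
  exact absurd (ht' S hS) (not_le.2 hlt')

lemma toughness_le_of_isCutset {S : Set V} {q : ℝ} (hS : IsCutset G S)
    (hq : (S.ncard : ℝ) ≤ q * numComponents G S) : toughness G ≤ (q : EReal) := by
  have hpos : (0 : ℝ) < numComponents G S := by
    exact_mod_cast (lt_trans zero_lt_one hS)
  refine iSup₂_le fun t' ht' => EReal.coe_le_coe_iff.2 ?_
  exact le_of_mul_le_mul_right ((ht' S hS).trans hq) hpos

lemma numComponents_empty_le_one [Finite V] (ht0 : 0 < t) (h : IsTough G t) :
    numComponents G ∅ ≤ 1 := by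
  by_contra! hlt
  have h1 := h ∅ hlt
  have h2 : (0 : ℝ) < numComponents G ∅ := by exact_mod_cast (lt_trans zero_lt_one hlt)
  rw [Set.ncard_empty, Nat.cast_zero] at h1
  exact absurd (mul_pos ht0 h2) (not_lt.2 h1)

lemma linked_empty_of_isTough [Finite V] (ht0 : 0 < t) (h : IsTough G t) (a b : V) :
    Linked G ∅ a b := by
  classical
  by_contra hl
  have hne : a ≠ b := fun h => hl (.of_eq h)
  have hsep : Separated G ∅ {a, b} := by
    refine ⟨fun _ _ => id, ?_⟩
    simp only [Finset.mem_insert, Finset.mem_singleton]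
    rintro c (rfl | rfl) d (rfl | rfl) hcd
    · rfl
    · exact absurd hcd hl
    · exact absurd hcd.symm hl
    · rfl
  have := hsep.card_le
  rw [Finset.card_pair hne] at this
  have := numComponents_empty_le_one ht0 h
  omega

lemma IsTough.mul_numComponents_le [Finite V] (ht : t ≤ 1 / 2) (ht0 : 0 < t) (h : IsTough G t)
    {S : Set V} (hS : S.Nonempty) : t * numComponents G S ≤ S.ncard := by
  by_cases hcut : IsCutset G S
  · exact h S hcut
  · have h1 : (numComponents G S : ℝ) ≤ 1 := by
      exact_mod_cast not_lt.1 hcut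
    have h2 : (1 : ℝ) ≤ S.ncard := by
      exact_mod_cast (Set.ncard_pos (Set.toFinite S)).2 hS
    nlinarith

/-- A set `S` witnessing that the deletion of the edge `xz` lowers the toughness below `t`:
the edge is a bridge of `G - S`, and `G - S` has as many components as `t`-toughness permits. -/
def IsCriticalFor (G : SimpleGraph V) (t : ℝ) (S : Set V) (x z : V) : Prop :=
  x ∉ S ∧ z ∉ S ∧ ¬ Linked (G.deleteEdges {s(x, z)}) S x z ∧
    (S.ncard : ℝ) < t * (numComponents G S + 1)

lemma exists_isCriticalFor [Finite V] (ht0 : 0 < t) (h : IsMinimallyTough G t) {x z : V}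
    (hxz : G.Adj x z) : ∃ S, IsCriticalFor G t S x z := by
  have hG := isTough_of_toughness_eq h.1
  have hlt := h.2 s(x, z) hxz
  have hnot : ¬ IsTough (G.deleteEdges {s(x, z)}) t := fun h' =>
    absurd h'.le_toughness (not_le.2 hlt)
  unfold IsTough at hnot
  push Not at hnot
  obtain ⟨S, hcut, hS⟩ := hnot
  have hmore : numComponents G S < numComponents (G.deleteEdges {s(x, z)}) S := by
    by_contra! hle
    have h1 := hG S (lt_of_lt_of_le hcut hle)
    have h2 : (numComponents (G.deleteEdges {s(x, z)}) S : ℝ) ≤ numComponents G S := by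
      exact_mod_cast hle
    nlinarith
  obtain ⟨h1, h2, h3, h4⟩ := numComponents_deleteEdges hmore
  refine ⟨S, h1, h2, h3, ?_⟩
  have h5 : (numComponents (G.deleteEdges {s(x, z)}) S : ℝ) ≤ numComponents G S + 1 := by
    exact_mod_cast h4
  nlinarith

end Toughness

/-! ### Blocks of minimally tough chordal graphs -/

section Star

variable {V : Type u} {G : SimpleGraph V} {t : ℝ}

lemma linked_deleteEdges_of_linked_insert {S : Set V} {x z a b : V}
    (h : Linked G (insert x S) a b) : Linked (G.deleteEdges {s(x, z)}) S a b := by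
  refine h.mem_of_closed (P := fun b => Linked (G.deleteEdges {s(x, z)}) S a b) (.refl ..) ?_
  intro p q hp hpq hpS hqS
  simp only [Set.mem_insert_iff, not_or] at hpS hqS
  exact hp.trans (.of_adj (by simp [hpq, hpS.1, hqS.1]) hpS.2 hqS.2)

/-- Let the neighbours of `c` in the component `D` of `G - c` containing the edge `xz` be
pairwise adjacent, and let `x` and `z` be neighbours of `c`. Then `xz` is a bridge of `G - c`.
A critical set `S` for `xz` contains `c`, and no member of `D`: the component of `x` is the only
component of `G - S` adjacent to both `S ∩ D` and `S \ D`, so one of these sets would violate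
the toughness condition if both were nonempty. -/
lemma not_linked_deleteEdges_of_clique [Finite V]
    (htough : ∀ S : Set V, S.Nonempty → t * numComponents G S ≤ S.ncard) (ht0 : 0 < t)
    {S : Set V} {c x z : V} (hS : IsCriticalFor G t S x z) (hcx : G.Adj c x) (hcz : G.Adj c z)
    (hclique : ∀ q, G.Adj c q → Linked G {c} x q → q = x ∨ G.Adj q x) :
    ¬ Linked (G.deleteEdges {s(x, z)}) {c} x z := by
  classical
  obtain ⟨hxS, hzS, hnl, hlt⟩ := hS
  have hcS : c ∈ S := by
    by_contra hcS
    refine hnl (.trans (b := c) (.of_adj ?_ hxS hcS) (.of_adj ?_ hcS hzS))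
    · simp [hcx.symm, hcx.ne, hcz.ne]
    · simp [hcz, hcx.ne, hcz.ne]
  let S' : Set V := {d ∈ S | Linked G {c} x d}
  let U : Set V := {d ∈ S | ¬ Linked G {c} x d}
  have hx : x ∉ ({c} : Set V) := hcx.ne'
  have hcU : c ∈ U := ⟨hcS, fun h => h.notMem hx rfl⟩
  have hunion : S' ∪ U = S := by
    ext d; simp only [S', U, Set.mem_union, Set.mem_ofPred_eq]; tauto
  have hdisj : Disjoint S' U := Set.disjoint_left.2 fun d hd hd' => hd'.2 hd.2
  have hS' : ¬ S'.Nonempty := by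
    intro hne
    have hle := numComponents_union_add_one_le (G := G) hdisj hne ⟨c, hcU⟩ (k := x) (by
      rw [hunion]
      rintro p q hpq hpS ⟨s, hs, hps⟩ ⟨w, hw, hqw⟩
      have hsub : ({c} : Set V) ⊆ S := Set.singleton_subset_iff.2 hcS
      have hpc : p ∉ ({c} : Set V) := fun h => hpS (hsub h)
      have hqS := hpq.notMem hpS
      have hqc : q ∉ ({c} : Set V) := fun h => hqS (hsub h)
      have hxq : Linked G {c} x q :=
        (hs.2.trans (.of_adj hps.symm (hs.2.notMem hx) hpc)).trans (hpq.mono le_rfl hsub)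
      have hwc : w = c := by
        by_contra hwc
        exact hw.2 (hxq.trans (.of_adj hqw hqc hwc))
      subst hwc
      rcases hclique q hqw.symm hxq with rfl | h
      · exact hpq
      · exact hpq.trans (.of_adj h hqS hxS))
    rw [hunion] at hle
    have h1 := htough S' hne
    have h2 := htough U ⟨c, hcU⟩
    have h3 := Set.ncard_union_eq hdisj
    rw [hunion] at h3
    have h4 : (numComponents G S + 1 : ℝ) ≤ numComponents G S' + numComponents G U := by
      exact_mod_cast hle
    have h5 : (S.ncard : ℝ) = S'.ncard + U.ncard := by exact_mod_cast h3
    nlinarith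
  intro hl
  refine hnl (hl.mem_of_closed (P := fun y => Linked (G.deleteEdges {s(x, z)}) S x y ∧
    Linked G {c} x y) ⟨.refl .., .refl ..⟩ ?_).1
  rintro p q ⟨hp, hp'⟩ hpq hpc hqc
  have hq' : Linked G {c} x q := hp'.trans (.of_adj ((deleteEdges_le _) hpq) hpc hqc)
  exact ⟨hp.trans (.of_adj hpq (hp.notMem hxS) fun h => hS' ⟨q, h, hq'⟩), hq'⟩

/-- In a chordal graph in which every edge has a critical set, two neighbours of `s` in the same
component of `G - s` are equal or adjacent; that is, every block is a clique.
Otherwise let `B` be a maximal set containing `s`, `a` and `b` no two of whose members are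
separated by a single vertex, and let `c` be a simplicial vertex of `B`. All neighbours of `c` in
the component of `G - c` meeting `B` belong to `B`, so an edge `xz` between two of them is
a bridge of `G - c`, which leaves no room in `B` for a further vertex. -/
lemma eq_or_adj_of_linked [Finite V] (hG : IsChordal G) (ht0 : 0 < t)
    (htough : ∀ S : Set V, S.Nonempty → t * numComponents G S ≤ S.ncard)
    (hcrit : ∀ x z, G.Adj x z → ∃ S, IsCriticalFor G t S x z) {s a b : V}
    (hsa : G.Adj s a) (hsb : G.Adj s b) (hab : Linked G {s} a b) : a = b ∨ G.Adj a b := by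
  classical
  have := Fintype.ofFinite V
  by_contra! hcon
  obtain ⟨hne, hnadj⟩ := hcon
  let E : V → V → Prop := fun x y => ∀ d, d ≠ x → d ≠ y → Linked G {d} x y
  have hEsymm : ∀ {x y}, E x y → E y x := fun h d hx hy => (h d hy hx).symm
  have hEadj : ∀ {x y}, G.Adj x y → E x y := fun h d hx hy => .of_adj h hx.symm hy.symm
  have hErefl : ∀ x, E x x := fun x d _ _ => .refl ..
  have hEab : E a b := by
    intro d hda hdb
    by_cases hds : d = s
    · exact hds ▸ hab
    · exact (hEadj hsa.symm d hda hds).trans (hEadj hsb d hds hdb)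
  let good : Finset V → Prop := fun B => s ∈ B ∧ a ∈ B ∧ b ∈ B ∧ ∀ x ∈ B, ∀ y ∈ B, E x y
  have hgood₀ : {s, a, b} ∈ Finset.univ.filter good := by
    simp only [Finset.mem_filter, Finset.mem_univ, true_and, good, Finset.mem_insert,
      Finset.mem_singleton, true_or, or_true]
    rintro x (rfl | rfl | rfl) y (rfl | rfl | rfl)
    · exact hErefl _
    · exact hEadj hsa
    · exact hEadj hsb
    · exact hEsymm (hEadj hsa)
    · exact hErefl _
    · exact hEab
    · exact hEsymm (hEadj hsb)
    · exact hEsymm hEab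
    · exact hErefl _
  obtain ⟨B, hBmem, hBmax⟩ := Finset.exists_max_image _ Finset.card ⟨_, hgood₀⟩
  obtain ⟨hsB, haB, hbB, hBE⟩ : good B := (Finset.mem_filter.1 hBmem).2
  have hmax : ∀ z, (∀ x ∈ B, E x z) → z ∈ B := by
    intro z hz
    by_contra hzB
    have hmem : insert z B ∈ Finset.univ.filter good := by
      simp only [Finset.mem_filter, Finset.mem_univ, true_and, good]
      refine ⟨Finset.mem_insert_of_mem hsB, Finset.mem_insert_of_mem haB,
        Finset.mem_insert_of_mem hbB, fun x hx y hy => ?_⟩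
      rcases Finset.mem_insert.1 hx with hx | hx <;> rcases Finset.mem_insert.1 hy with hy | hy
      · rw [hx, hy]; exact hErefl z
      · rw [hx]; exact hEsymm (hz y hy)
      · rw [hy]; exact hz x hx
      · exact hBE x hx y hy
    have := hBmax _ hmem
    rw [Finset.card_insert_of_notMem hzB] at this
    omega
  -- neighbours of a member `c` of `B` in the component of `G - c` meeting `B` lie in `B`
  have hnb : ∀ c ∈ B, ∀ w ∈ B, w ≠ c → ∀ z, G.Adj c z → Linked G {c} z w → z ∈ B := by
    intro c hc w hw hwc z hcz hl
    refine hmax z fun x hx d hdx hdz => ?_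
    by_cases hdc : d = c
    · subst hdc
      exact (hBE x hx w hw d hdx hwc.symm).trans hl.symm
    · exact (hBE x hx c hc d hdx hdc).trans (hEadj hcz d hdc hdz)
  obtain ⟨c, hc, hclique⟩ := hG.exists_simplicial B ⟨s, hsB⟩
  obtain ⟨p, hp, q, hq, hpc, hqc, hpq⟩ : ∃ p ∈ B, ∃ q ∈ B, p ≠ c ∧ q ≠ c ∧ p ≠ q := by
    by_cases h1 : a = c
    · exact ⟨s, hsB, b, hbB, h1 ▸ hsa.ne, h1 ▸ hne.symm, hsb.ne⟩
    · by_cases h2 : b = c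
      · exact ⟨s, hsB, a, haB, h2 ▸ hsb.ne, h1, hsa.ne⟩
      · exact ⟨a, haB, b, hbB, h1, h2, hne⟩
  -- a member of `B` other than `c` and `y` reaches a neighbour of `c` other than `y`
  have hreach : ∀ w ∈ B, ∀ y, w ≠ c → y ≠ w → y ≠ c →
      ∃ x ∈ B, x ≠ y ∧ G.Adj c x ∧ Linked G (insert y {c}) w x := by
    intro w hw y hwc hyw hyc
    obtain ⟨x, hxc, hxy, hl⟩ := (hBE w hw c hc y hyw hyc).exists_adj hwc
    refine ⟨x, hnb c hc w hw hwc x hxc.symm (hl.symm.mono le_rfl ?_), hxy, hxc.symm, ?_⟩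
    · simp
    · rwa [Set.pair_comm]
  obtain ⟨x, hxB, -, hcx, -⟩ := hreach p hp q hpc hpq.symm hqc
  obtain ⟨z, hzB, hzx, hcz⟩ : ∃ z ∈ B, z ≠ x ∧ G.Adj c z := by
    by_cases hqx : x = q
    · obtain ⟨z, hz, hzx, hcz, -⟩ := hreach p hp x hpc (hqx ▸ hpq.symm) hcx.ne'
      exact ⟨z, hz, hzx, hcz⟩
    · obtain ⟨z, hz, hzx, hcz, -⟩ := hreach q hq x hqc hqx hcx.ne'
      exact ⟨z, hz, hzx, hcz⟩
  have hxz : G.Adj x z := hclique x hxB z hzB hcx hcz hzx.symm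
  obtain ⟨S, hS⟩ := hcrit x z hxz
  have hbridge := not_linked_deleteEdges_of_clique htough ht0 hS hcx hcz (fun q hcq hl => by
    by_cases hqx : q = x
    · exact Or.inl hqx
    · exact Or.inr (hclique q (hnb c hc x hxB hcx.ne' q hcq hl.symm) x hxB hcq hcx hqx))
  obtain ⟨d, hd, hdc, hdx, hdz⟩ : ∃ d ∈ B, d ≠ c ∧ d ≠ x ∧ d ≠ z := by
    by_contra! hno
    have hpair : ∀ u v, (u = c ∨ u = x ∨ u = z) → (v = c ∨ v = x ∨ v = z) →
        u = v ∨ G.Adj u v := by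
      have hcx' := hcx.symm
      have hcz' := hcz.symm
      have hxz' := hxz.symm
      rintro u v (hu | hu | hu) (hv | hv | hv) <;> rw [hu, hv] <;>
        first | exact Or.inl rfl | exact Or.inr (by assumption)
    have hmem : ∀ u ∈ B, u = c ∨ u = x ∨ u = z := fun u hu => by
      have := hno u hu
      tauto
    rcases hpair a b (hmem a haB) (hmem b hbB) with h | h
    · exact hne h
    · exact hnadj h
  have hkey : ∀ x z, x ∈ B → z ∈ B → G.Adj c x → G.Adj c z → x ≠ z → d ≠ x →
      Linked (G.deleteEdges {s(x, z)}) {c} d z := by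
    intro x z hxB hzB hcx hcz hxz hdx
    obtain ⟨q, hqB, hqx, hcq, hl⟩ := hreach d hd x hdc hdx.symm hcx.ne'
    have hl' : Linked (G.deleteEdges {s(x, z)}) {c} d q := linked_deleteEdges_of_linked_insert hl
    by_cases hqz : q = z
    · exact hqz ▸ hl'
    · refine hl'.trans (.of_adj ?_ hcq.ne' hcz.ne')
      simp [hclique q hqB z hzB hcq hcz hqz, hqx, hqz]
  have h1 := hkey x z hxB hzB hcx hcz hzx.symm hdx
  have h2 := hkey z x hzB hxB hcz hcx hzx hdz
  rw [Sym2.eq_swap] at h2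
  exact hbridge (h2.symm.trans h1)

end Star

/-! ### Graphs whose blocks are edges and triangles -/

section TriangleTree

variable {V : Type u} {G : SimpleGraph V} {t : ℝ}

/-- Connected graphs all of whose blocks are edges or triangles, described without blocks:
neighbours of `s` in a common component of `G - s` are equal or adjacent, and the ends of an
edge have at most one common neighbour. -/
structure IsTriangleTree (G : SimpleGraph V) : Prop where
  linked : ∀ a b, Linked G ∅ a b
  eq_or_adj : ∀ {s a b}, G.Adj s a → G.Adj s b → Linked G {s} a b → a = b ∨ G.Adj a b
  eq_of_common : ∀ {a b c d}, G.Adj a b → G.Adj a c → G.Adj b c → G.Adj a d → G.Adj b d → c = d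

lemma numComponents_add_card_le [Finite V]
    (hstar : ∀ {s a b}, G.Adj s a → G.Adj s b → Linked G {s} a b → a = b ∨ G.Adj a b)
    (hconn : numComponents G ∅ ≤ 1) {m : ℕ} (hm : ∀ v, modifiedDegree G v ≤ m)
    (S : Set V) : numComponents G S + S.ncard ≤ 1 + m * S.ncard := by
  induction S, S.toFinite using Set.Finite.induction_on with
  | empty => simpa using hconn
  | @insert s S hs _ ih =>
    have h1 := numComponents_insert_add_one_le hs fun a b => hstar (s := s) (a := a) (b := b)
    have h2 : numComponents G {s} ≤ m := hm s
    rw [Set.ncard_insert_of_notMem hs, mul_add, mul_one, ← Set.union_singleton]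
    omega

variable [Fintype V]

lemma modifiedDegree_le_max (G : SimpleGraph V) (v : V) :
    modifiedDegree G v ≤ maxModifiedDegree G :=
  Finset.le_sup (f := modifiedDegree G) (Finset.mem_univ v)

/-- In a graph of toughness at most `1 / 2` whose blocks are cliques, single vertices are the
worst cutsets: a further vertex adds at most `μ - 1` components. -/
lemma toughness_eq_one_div
    (hstar : ∀ {s a b}, G.Adj s a → G.Adj s b → Linked G {s} a b → a = b ∨ G.Adj a b)
    (ht0 : 0 < t) (ht : t ≤ 1 / 2) (h : toughness G = (t : EReal)) :
    2 ≤ maxModifiedDegree G ∧ t = 1 / (maxModifiedDegree G : ℝ) := by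
  have hG := isTough_of_toughness_eq h
  have hconn := numComponents_empty_le_one ht0 hG
  have hle := numComponents_add_card_le hstar hconn (modifiedDegree_le_max G)
  set m := maxModifiedDegree G with hmdef
  have hbound : ∀ q : ℝ, IsTough G q → q ≤ t := fun q hq => by
    have := hq.le_toughness
    rwa [h, EReal.coe_le_coe_iff] at this
  have hm0 : 1 ≤ m := by
    by_contra! hlt
    have : m = 0 := by omega
    have h1 : IsTough G 1 := by
      intro S hS
      have := hle S
      have hS : 1 < numComponents G S := hS
      simp only [‹m = 0›, zero_mul] at this
      omega
    have := hbound 1 h1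
    linarith
  have hmpos : (0 : ℝ) < m := by exact_mod_cast hm0
  have hlow : 1 / (m : ℝ) ≤ t := by
    refine hbound _ fun S hS => ?_
    have h1 := hle S
    have h0 : 1 ≤ S.ncard := by
      by_contra! hlt
      have hS0 : S = ∅ := (Set.ncard_eq_zero S.toFinite).1 (by omega)
      have hS' : 1 < numComponents G S := hS
      rw [hS0] at hS'
      omega
    have h2 : numComponents G S ≤ m * S.ncard := by omega
    have h3 : (numComponents G S : ℝ) ≤ m * S.ncard := by exact_mod_cast h2
    rw [div_mul_eq_mul_div, one_mul, div_le_iff₀ hmpos]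
    linarith
  have hm2 : 2 ≤ m := by
    have h1 : 1 / (m : ℝ) ≤ 1 / 2 := hlow.trans ht
    have h2 := (one_div_le_one_div hmpos two_pos).1 h1
    exact_mod_cast h2
  refine ⟨hm2, le_antisymm ?_ hlow⟩
  have hne : (Finset.univ : Finset V).Nonempty := by
    by_contra hempty
    rw [Finset.not_nonempty_iff_eq_empty] at hempty
    have : m = 0 := by rw [hmdef, maxModifiedDegree, hempty]; rfl
    omega
  obtain ⟨v, -, hv⟩ := Finset.exists_mem_eq_sup _ hne (modifiedDegree G)
  have hv : numComponents G {v} = m := hv.symm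
  have h1 := hG {v} (by unfold IsCutset; omega)
  rw [hv, Set.ncard_singleton, Nat.cast_one] at h1
  rwa [le_div_iff₀ hmpos]

/-- The structure of minimally `t`-tough chordal graphs with `t ≤ 1 / 2`: critical sets have at
most one member, so an edge has at most one common neighbour, of modified degree `1 / t`. -/
lemma IsMinimallyTough.isTriangleTree (hG : IsChordal G) (ht0 : 0 < t) (ht : t ≤ 1 / 2)
    (h : IsMinimallyTough G t) :
    IsTriangleTree G ∧ 2 ≤ maxModifiedDegree G ∧ t = 1 / (maxModifiedDegree G : ℝ) ∧
      ∀ x z c, G.Adj x z → G.Adj x c → G.Adj z c → modifiedDegree G c = maxModifiedDegree G := by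
  have htough := isTough_of_toughness_eq h.1
  have hcrit : ∀ x z, G.Adj x z → ∃ S, IsCriticalFor G t S x z := fun x z hxz =>
    exists_isCriticalFor ht0 h hxz
  have hstar : ∀ {s a b}, G.Adj s a → G.Adj s b → Linked G {s} a b → a = b ∨ G.Adj a b :=
    eq_or_adj_of_linked hG ht0 (fun S hS => htough.mul_numComponents_le ht ht0 hS) hcrit
  obtain ⟨hm2, hm⟩ := toughness_eq_one_div hstar ht0 ht h.1
  have hle := numComponents_add_card_le hstar (numComponents_empty_le_one ht0 htough)
    (modifiedDegree_le_max G)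
  have hone : ∀ x z, G.Adj x z → ∃ S : Set V, ∀ c, G.Adj x c → G.Adj z c →
      S = {c} ∧ modifiedDegree G c = maxModifiedDegree G := by
    intro x z hxz
    obtain ⟨S, hxS, hzS, hnl, hlt⟩ := hcrit x z hxz
    refine ⟨S, fun c hxc hzc => ?_⟩
    have hcS : c ∈ S := by
      by_contra hcS
      refine hnl (.trans (b := c) (.of_adj ?_ hxS hcS) (.of_adj ?_ hcS hzS))
      · simp [hxc, hxz.ne, hxc.ne', hzc.ne']
      · simp [hzc.symm, hxc.ne', hzc.ne']
    have hmpos : (0 : ℝ) < maxModifiedDegree G := by exact_mod_cast (by omega)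
    have h1 : maxModifiedDegree G * S.ncard < numComponents G S + 1 := by
      rw [hm, div_mul_eq_mul_div, one_mul, lt_div_iff₀ hmpos] at hlt
      have : ((maxModifiedDegree G * S.ncard : ℕ) : ℝ) < (numComponents G S + 1 : ℕ) := by
        push_cast
        linarith
      exact_mod_cast this
    have h2 := hle S
    have hS1 : S = {c} := by
      have : S.ncard = 1 :=
        le_antisymm (by omega) ((Set.ncard_pos S.toFinite).2 ⟨c, hcS⟩)
      obtain ⟨d, rfl⟩ := Set.ncard_eq_one.1 this
      rw [Set.mem_singleton_iff.1 hcS]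
    refine ⟨hS1, le_antisymm (modifiedDegree_le_max G c) ?_⟩
    rw [hS1, Set.ncard_singleton] at h1
    unfold modifiedDegree
    omega
  refine ⟨⟨linked_empty_of_isTough ht0 htough, hstar, ?_⟩, hm2, hm, ?_⟩
  · intro a b c d hab hac hbc had hbd
    obtain ⟨S, hS⟩ := hone a b hab
    exact Set.singleton_injective ((hS c hac hbc).1.symm.trans (hS d had hbd).1)
  · intro x z c hxz hxc hzc
    obtain ⟨S, hS⟩ := hone x z hxz
    exact (hS c hxc hzc).2

end TriangleTree

/-! ### The tree obtained by replacing triangles by stars -/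

section StarTree

variable {V : Type u} {G : SimpleGraph V}

/-- The tree obtained from a graph whose blocks are edges and triangles by replacing each triangle
by a star: its vertices are those of `G` and the triangles of `G`; a triangle is joined to its
three members, and two vertices of `G` are joined if they form an edge that is in no triangle. -/
def starTree (G : SimpleGraph V) : SimpleGraph (V ⊕ {σ : Finset V // G.IsNClique 3 σ}) where
  Adj
    | .inl a, .inl b => G.Adj a b ∧ ∀ c, G.Adj a c → ¬ G.Adj b c
    | .inl a, .inr σ => a ∈ σ.1
    | .inr σ, .inl a => a ∈ σ.1
    | .inr _, .inr _ => False
  symm := ⟨by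
    rintro (a | σ) (b | τ) h
    · exact ⟨h.1.symm, fun c hc hc' => h.2 c hc' hc⟩
    · exact h
    · exact h
    · exact h⟩
  loopless := ⟨by
    rintro (a | σ) h
    · exact h.1.ne rfl
    · exact h⟩

/-- The vertices of `starTree G` on the side of `d` once `v` is deleted: the vertices of the
component `D` of `d` in `G - v` and the triangles meeting `D`. -/
def OnSide (G : SimpleGraph V) (v d : V) : V ⊕ {σ : Finset V // G.IsNClique 3 σ} → Prop
  | .inl x => Linked G {v} d x
  | .inr σ => ∃ x ∈ σ.1, Linked G {v} d x

lemma adj_of_mem_triangle {σ : Finset V} (hσ : G.IsNClique 3 σ) {x y : V} (hx : x ∈ σ)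
    (hy : y ∈ σ) (h : x ≠ y) : G.Adj x y :=
  hσ.1 hx hy h

lemma exists_third {σ : Finset V} (hσ : G.IsNClique 3 σ) (x y : V) :
    ∃ z ∈ σ, z ≠ x ∧ z ≠ y := by
  classical
  have h1 := Finset.card_le_card_sdiff_add_card (s := σ) (t := {x, y})
  have h2 := Finset.card_le_two (a := x) (b := y)
  have h3 := hσ.card_eq
  obtain ⟨z, hz⟩ : (σ \ {x, y}).Nonempty := Finset.card_pos.1 (by omega)
  simp only [Finset.mem_sdiff, Finset.mem_insert, Finset.mem_singleton, not_or] at hz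
  exact ⟨z, hz⟩

lemma exists_triangle {a b c : V} (hab : G.Adj a b) (hac : G.Adj a c) (hbc : G.Adj b c) :
    ∃ σ : {σ : Finset V // G.IsNClique 3 σ}, a ∈ σ.1 ∧ b ∈ σ.1 ∧ c ∈ σ.1 := by
  classical
  exact ⟨⟨{a, b, c}, is3Clique_triple_iff.2 ⟨hab, hac, hbc⟩⟩, by simp, by simp, by simp⟩

/-- A common neighbour of two members of a triangle belongs to the triangle. -/
lemma IsTriangleTree.mem_of_common (hG : IsTriangleTree G) {σ : Finset V} (hσ : G.IsNClique 3 σ)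
    {v x y : V} (hv : v ∈ σ) (hx : x ∈ σ) (hvx : v ≠ x) (hvy : G.Adj v y) (hxy : G.Adj x y) :
    y ∈ σ := by
  obtain ⟨z, hz, hzv, hzx⟩ := exists_third hσ v x
  rwa [← hG.eq_of_common (adj_of_mem_triangle hσ hv hx hvx)
    (adj_of_mem_triangle hσ hv hz hzv.symm) (adj_of_mem_triangle hσ hx hz hzx.symm) hvy hxy]

lemma IsTriangleTree.triangle_eq (hG : IsTriangleTree G)
    {σ τ : {σ : Finset V // G.IsNClique 3 σ}} {v x : V} (hvx : v ≠ x)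
    (hv : v ∈ σ.1) (hx : x ∈ σ.1) (hv' : v ∈ τ.1) (hx' : x ∈ τ.1) : σ = τ := by
  refine Subtype.ext (Finset.eq_of_subset_of_card_le (fun y hy => ?_)
    (by rw [σ.2.card_eq, τ.2.card_eq]))
  by_cases hyv : y = v
  · exact hyv ▸ hv'
  by_cases hyx : y = x
  · exact hyx ▸ hx'
  exact hG.mem_of_common τ.2 hv' hx' hvx (adj_of_mem_triangle σ.2 hv hy (Ne.symm hyv))
    (adj_of_mem_triangle σ.2 hx hy (Ne.symm hyx))

/-- The vertex `v` has at most one neighbour of `starTree G` on each side. -/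
lemma IsTriangleTree.neighbor_unique (hG : IsTriangleTree G) {v d : V} (hdv : d ≠ v)
    {w w' : V ⊕ {σ : Finset V // G.IsNClique 3 σ}} (hw : (starTree G).Adj (.inl v) w)
    (hw' : (starTree G).Adj (.inl v) w') (hs : OnSide G v d w) (hs' : OnSide G v d w') :
    w = w' := by
  have hne : ∀ {x}, Linked G {v} d x → v ≠ x := fun h h' => h.notMem hdv h'.symm
  rcases w with x | σ <;> rcases w' with x' | τ
  · rcases hG.eq_or_adj hw.1 hw'.1 (hs.symm.trans hs') with rfl | h
    · rfl
    · exact absurd h (hw.2 x' hw'.1)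
  · obtain ⟨y, hy, hl⟩ := hs'
    obtain ⟨z, hz, hzv, hzy⟩ := exists_third τ.2 v y
    have hvy := adj_of_mem_triangle τ.2 hw' hy (hne hl)
    rcases hG.eq_or_adj hw.1 hvy (hs.symm.trans hl) with rfl | h
    · exact absurd (adj_of_mem_triangle τ.2 hy hz hzy.symm)
        (hw.2 z (adj_of_mem_triangle τ.2 hw' hz hzv.symm))
    · exact absurd h (hw.2 y hvy)
  · obtain ⟨y, hy, hl⟩ := hs
    obtain ⟨z, hz, hzv, hzy⟩ := exists_third σ.2 v y
    have hvy := adj_of_mem_triangle σ.2 hw hy (hne hl)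
    rcases hG.eq_or_adj hw'.1 hvy (hs'.symm.trans hl) with rfl | h
    · exact absurd (adj_of_mem_triangle σ.2 hy hz hzy.symm)
        (hw'.2 z (adj_of_mem_triangle σ.2 hw hz hzv.symm))
    · exact absurd h (hw'.2 y hvy)
  · obtain ⟨x, hx, hl⟩ := hs
    obtain ⟨y, hy, hl'⟩ := hs'
    have hvx := adj_of_mem_triangle σ.2 hw hx (hne hl)
    have hvy := adj_of_mem_triangle τ.2 hw' hy (hne hl')
    have hyσ : y ∈ σ.1 := by
      rcases hG.eq_or_adj hvx hvy (hl.symm.trans hl') with rfl | h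
      · exact hx
      · exact hG.mem_of_common σ.2 hw hx hvx.ne hvy h
    rw [hG.triangle_eq hvy.ne hw hyσ hw' hy]

/-- In `starTree G`, a side of `v` can only be left through `v`. -/
lemma OnSide.of_adj {v d : V} (hdv : d ≠ v)
    {w w' : V ⊕ {σ : Finset V // G.IsNClique 3 σ}} (hs : OnSide G v d w)
    (h : (starTree G).Adj w w') (hw' : w' ≠ .inl v) : OnSide G v d w' := by
  have hne : ∀ {x}, Linked G {v} d x → x ∉ ({v} : Set V) := fun h => h.notMem hdv
  rcases w with x | σ <;> rcases w' with y | τ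
  · exact hs.trans (.of_adj h.1 (hne hs) fun hy => hw' (congrArg _ hy))
  · exact ⟨x, h, hs⟩
  · obtain ⟨x, hx, hl⟩ := hs
    by_cases hxy : x = y
    · exact hxy ▸ hl
    · exact hl.trans (.of_adj (adj_of_mem_triangle σ.2 hx h hxy) (hne hl)
        fun hy => hw' (congrArg _ hy))
  · exact h.elim

lemma exists_onSide {v : V} {w : V ⊕ {σ : Finset V // G.IsNClique 3 σ}}
    (hw : (starTree G).Adj (.inl v) w) : ∃ d, d ≠ v ∧ OnSide G v d w := by
  rcases w with x | σ
  · exact ⟨x, hw.1.ne', .refl ..⟩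
  · obtain ⟨z, hz, hzv, -⟩ := exists_third σ.2 v v
    exact ⟨z, hzv, z, hz, .refl ..⟩

lemma exists_neighbor_onSide {v d q : V} (hvq : G.Adj v q) (hl : Linked G {v} d q) :
    ∃ w, (starTree G).Adj (.inl v) w ∧ OnSide G v d w := by
  by_cases hc : ∃ c, G.Adj v c ∧ G.Adj q c
  · obtain ⟨c, hvc, hqc⟩ := hc
    obtain ⟨σ, hv, hq, -⟩ := exists_triangle hvq hvc hqc
    exact ⟨.inr σ, hv, q, hq, hl⟩
  · push Not at hc
    exact ⟨.inl q, ⟨hvq, hc⟩, hl⟩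

lemma OnSide.linked {v d d' : V} (hd : d ≠ v) (hd' : d' ≠ v)
    {w : V ⊕ {σ : Finset V // G.IsNClique 3 σ}} (h : OnSide G v d w) (h' : OnSide G v d' w) :
    Linked G {v} d d' := by
  rcases w with x | σ
  · exact Linked.trans h h'.symm
  · obtain ⟨x, hx, hl⟩ := h
    obtain ⟨y, hy, hl'⟩ := h'
    refine (hl.trans ?_).trans hl'.symm
    by_cases hxy : x = y
    · exact .of_eq hxy
    · exact .of_adj (adj_of_mem_triangle σ.2 hx hy hxy) (hl.notMem hd) (hl'.notMem hd')

lemma IsTriangleTree.isAcyclic_starTree (hG : IsTriangleTree G) : (starTree G).IsAcyclic := by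
  have key : ∀ v w, (starTree G).Adj (.inl v) w → (starTree G).IsBridge s(.inl v, w) := by
    intro v w hw
    rw [isBridge_iff]
    intro hr
    obtain ⟨d, hdv, hd⟩ := exists_onSide hw
    have hl := (reachable_iff_linked_empty.1 hr).symm
    have : OnSide G v d (.inl v) := by
      refine hl.mem_of_closed (P := OnSide G v d) hd ?_
      intro y y' hy hyy' _ _
      rw [deleteEdges_adj] at hyy'
      by_cases hy' : y' = .inl v
      · subst hy'
        have := hG.neighbor_unique hdv hw hyy'.1.symm hd hy
        subst this
        exact absurd (Sym2.eq_swap) hyy'.2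
      · exact hy.of_adj hdv hyy'.1 hy'
    exact Linked.notMem this hdv rfl
  rw [isAcyclic_iff_forall_adj_isBridge]
  rintro (v | σ) (w | τ) h
  · exact key _ _ h
  · exact key _ _ h
  · rw [Sym2.eq_swap]; exact key _ _ h.symm
  · exact h.elim

lemma IsTriangleTree.isTree_starTree [Nonempty V] (hG : IsTriangleTree G) :
    (starTree G).IsTree := by
  have hadj : ∀ a b, G.Adj a b → (starTree G).Reachable (.inl a) (.inl b) := by
    intro a b hab
    by_cases hc : ∃ c, G.Adj a c ∧ G.Adj b c
    · obtain ⟨c, hac, hbc⟩ := hc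
      obtain ⟨σ, ha, hb, -⟩ := exists_triangle hab hac hbc
      have h1 : (starTree G).Adj (.inl a) (.inr σ) := ha
      have h2 : (starTree G).Adj (.inr σ) (.inl b) := hb
      exact h1.reachable.trans h2.reachable
    · push Not at hc
      have h1 : (starTree G).Adj (.inl a) (.inl b) := ⟨hab, hc⟩
      exact h1.reachable
  have hinl : ∀ a b, (starTree G).Reachable (.inl a) (.inl b) := fun a b =>
    (hG.linked a b).mem_of_closed (P := fun b => (starTree G).Reachable (.inl a) (.inl b))
      (.refl _) fun x y hx hxy _ _ => hx.trans (hadj x y hxy)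
  have hex : ∀ w, ∃ a, (starTree G).Reachable w (.inl a) := by
    rintro (a | σ)
    · exact ⟨a, .refl _⟩
    · obtain ⟨a, ha⟩ : σ.1.Nonempty := Finset.card_pos.1 (by rw [σ.2.card_eq]; norm_num)
      have h1 : (starTree G).Adj (.inr σ) (.inl a) := ha
      exact ⟨a, h1.reachable⟩
  refine ⟨⟨fun w w' => ?_⟩, hG.isAcyclic_starTree⟩
  obtain ⟨a, ha⟩ := hex w
  obtain ⟨b, hb⟩ := hex w'
  exact (ha.trans (hinl a b)).trans hb.symm

lemma IsTriangleTree.degree_inl [Finite V] (hG : IsTriangleTree G) (v : V)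
    [Fintype ((starTree G).neighborSet (.inl v))] :
    (starTree G).degree (.inl v) = modifiedDegree G v := by
  classical
  rw [← card_neighborSet_eq_degree]
  refine le_antisymm ?_ ?_
  · choose f hf hs using fun w : (starTree G).neighborSet (.inl v) => exists_onSide w.2
    refine card_le_numComponents f hf fun i j hij => Subtype.ext ?_
    refine hG.neighbor_unique (hf i) i.2 j.2 (hs i) ?_
    have := hs j
    generalize (j : V ⊕ {σ : Finset V // G.IsNClique 3 σ}) = w at this
    rcases w with x | σ
    · exact hij.trans this
    · obtain ⟨x, hx, hl⟩ := this
      exact ⟨x, hx, hij.trans hl⟩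
  · obtain ⟨A, hA, hcard⟩ := exists_separated G {v}
    have hex : ∀ a : A, ∃ w, (starTree G).Adj (.inl v) w ∧ OnSide G v a w := by
      rintro ⟨a, ha⟩
      obtain ⟨q, hq, -, hl⟩ := (hG.linked a v).exists_adj (hA.1 a ha)
      refine exists_neighbor_onSide hq.symm (hl.mono le_rfl ?_)
      simp
    choose f hf hs using hex
    have := Fintype.card_le_of_injective
      (fun a => (⟨f a, hf a⟩ : (starTree G).neighborSet (.inl v))) (by
        intro a b hab
        have hab : f a = f b := congrArg Subtype.val hab
        refine Subtype.ext (hA.2 a a.2 b b.2 ((hs a).linked (hA.1 a a.2) (hA.1 b b.2) ?_))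
        exact hab ▸ hs b)
    rw [Fintype.card_coe, hcard] at this
    exact this

lemma degree_inr (σ : {σ : Finset V // G.IsNClique 3 σ})
    [Fintype ((starTree G).neighborSet (.inr σ))] : (starTree G).degree (.inr σ) = 3 := by
  have h : (starTree G).neighborFinset (.inr σ) = σ.1.map ⟨Sum.inl, Sum.inl_injective⟩ := by
    ext (a | τ)
    · have : (starTree G).Adj (.inr σ) (.inl a) ↔ a ∈ σ.1 := Iff.rfl
      simp [this]
    · have : ¬ (starTree G).Adj (.inr σ) (.inr τ) := id
      simp [this]
  rw [← card_neighborFinset_eq_degree, h, Finset.card_map, σ.2.card_eq]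

/-- Replacing the stars of `starTree G` by triangles again gives back `G`. -/
lemma nonempty_iso_replaceByCliques (G : SimpleGraph V) :
    Nonempty (G ≃g replaceByCliques (starTree G) (Set.range Sum.inr)) := by
  refine ⟨⟨Equiv.ofBijective (fun v => ⟨.inl v, by simp⟩) ⟨?_, ?_⟩, ?_⟩⟩
  · intro a b hab
    exact Sum.inl_injective (congrArg Subtype.val hab)
  · rintro ⟨a | σ, hw⟩
    · exact ⟨a, rfl⟩
    · exact absurd ⟨σ, rfl⟩ hw
  · intro a b
    constructor
    · rintro ⟨hne, h | ⟨-, ⟨σ, rfl⟩, ha, hb⟩⟩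
      · exact h.1
      · exact adj_of_mem_triangle σ.2 ha hb fun h => hne (congrArg _ h)
    · intro h
      refine ⟨fun h' => h.ne (Sum.inl_injective (congrArg Subtype.val h')), ?_⟩
      by_cases hc : ∃ c, G.Adj a c ∧ G.Adj b c
      · obtain ⟨c, hac, hbc⟩ := hc
        obtain ⟨σ, ha, hb, -⟩ := exists_triangle h hac hbc
        exact Or.inr ⟨.inr σ, ⟨σ, rfl⟩, ha, hb⟩
      · push Not at hc
        exact Or.inl ⟨h, hc⟩

lemma IsTriangleTree.isAcyclic_of_no_triangle (hG : IsTriangleTree G)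
    (h : ∀ a b c, G.Adj a b → G.Adj a c → ¬ G.Adj b c) : G.IsAcyclic := by
  rw [isAcyclic_iff_forall_adj_isBridge]
  intro a b hab
  rw [isBridge_iff]
  intro hr
  obtain ⟨q, hqa, -, hl⟩ := (reachable_iff_linked_empty.1 hr).symm.exists_adj hab.ne'
  rw [deleteEdges_adj] at hqa
  rcases hG.eq_or_adj hab hqa.1.symm (hl.mono (deleteEdges_le _) (by simp)) with rfl | hbq
  · exact hqa.2 Sym2.eq_swap
  · exact h a b q hab hqa.1.symm hbq

/-- A graph whose blocks are edges and triangles is a TT-graph if the members of its triangles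
have maximum modified degree. -/
lemma IsTriangleTree.isTTGraph [Fintype V] [Nonempty V] (hG : IsTriangleTree G)
    (hm : 2 ≤ maxModifiedDegree G)
    (hmax : ∀ x z c, G.Adj x z → G.Adj x c → G.Adj z c →
      modifiedDegree G c = maxModifiedDegree G) : IsTTGraph G := by
  classical
  by_cases htri : ∀ a b c, G.Adj a b → G.Adj a c → ¬ G.Adj b c
  · exact Or.inl ⟨⟨fun a b => reachable_iff_linked_empty.2 (hG.linked a b)⟩,
      hG.isAcyclic_of_no_triangle htri⟩
  push Not at htri
  obtain ⟨a, b, c, hab, hac, hbc⟩ := htri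
  obtain ⟨σ, haσ, hbσ, hcσ⟩ := exists_triangle hab hac hbc
  have hadj3 : 3 ≤ (starTree G).maxDegree := 
    (degree_inr σ).ge.trans (degree_le_maxDegree _ _)
  have hnb : ∀ y ∈ Set.range (Sum.inr : {σ : Finset V // G.IsNClique 3 σ} → V ⊕ _), ∀ x,
      (starTree G).Adj y x → (starTree G).degree x = maxModifiedDegree G := by
    rintro - ⟨τ, rfl⟩ (v | ρ) h
    · rw [hG.degree_inl]
      obtain ⟨x, hx, hxv, -⟩ := exists_third τ.2 v v
      obtain ⟨z, hz, hzv, hzx⟩ := exists_third τ.2 v x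
      exact hmax x z v (adj_of_mem_triangle τ.2 hx hz hzx.symm)
        (adj_of_mem_triangle τ.2 hx h hxv) (adj_of_mem_triangle τ.2 hz h hzv)
    · exact h.elim
  have hmaxdeg : ∀ k, 3 ≤ k → maxModifiedDegree G ≤ k → (starTree G).maxDegree ≤ k := by
    intro k h3 hk
    refine maxDegree_le_of_forall_degree_le _ _ ?_
    rintro (v | τ)
    · rw [hG.degree_inl]
      exact (modifiedDegree_le_max G v).trans hk
    · rw [degree_inr]; exact h3
  refine Or.inr ⟨V ⊕ {σ : Finset V // G.IsNClique 3 σ}, inferInstance, starTree G, inferInstance,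
    Set.range Sum.inr, hG.isTree_starTree, hadj3, ⟨?_, ?_⟩, nonempty_iso_replaceByCliques G⟩
  · rintro - ⟨σ, rfl⟩ - ⟨τ, rfl⟩ -
    exact id
  rcases hm.eq_or_lt with h2 | h3
  · left
    refine ⟨le_antisymm (hmaxdeg 3 le_rfl (by omega)) hadj3, ?_, ?_⟩
    · ext (v | τ)
      · have := modifiedDegree_le_max G v
        simp only [Set.mem_range, reduceCtorEq, exists_false, Set.mem_ofPred_eq, false_iff]
        rw [hG.degree_inl]
        omega
      · simp [degree_inr]
    · intro y hy x hx
      rw [hnb y hy x hx, h2]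
  · right
    refine ⟨hadj3, ?_, fun y hy x hx => ?_⟩
    · rintro - ⟨τ, rfl⟩
      exact degree_inr τ
    · have h1 := hnb (.inr σ) ⟨σ, rfl⟩ (.inl a) haσ
      have h2 := degree_le_maxDegree (starTree G) (.inl a)
      rw [hnb y hy x hx]
      exact le_antisymm (h1 ▸ h2) (hmaxdeg _ h3 le_rfl)

end StarTree

/-! ### TT-graphs are minimally tough -/

section Converse

variable {V W : Type u} {G : SimpleGraph V} {T : SimpleGraph W} {t : ℝ}

/-- Deleting a bridge brings the toughness down to at most `0`. -/
lemma toughness_deleteEdges_lt_of_isBridge [Finite V] (ht0 : 0 < t) {a b : V}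
    (h : G.IsBridge s(a, b)) : toughness (G.deleteEdges {s(a, b)}) < (t : EReal) := by
  by_contra! hle
  rw [isBridge_iff, reachable_iff_linked_empty] at h
  obtain ⟨q, hq, h1⟩ : ∃ q : ℝ, 0 < q ∧ IsTough (G.deleteEdges {s(a, b)}) q := by
    have h0 : ((0 : ℝ) : EReal) < toughness (G.deleteEdges {s(a, b)}) :=
      lt_of_lt_of_le (EReal.coe_lt_coe_iff.2 ht0) hle
    obtain ⟨q, h1⟩ := lt_iSup_iff.1 h0
    obtain ⟨h2, h1⟩ := lt_iSup_iff.1 h1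
    exact ⟨q, EReal.coe_lt_coe_iff.1 h1, h2⟩
  exact h (linked_empty_of_isTough hq h1 a b)

/-- Distinct neighbours of a vertex `r` of a tree lie in different components of `T - r`. -/
lemma eq_of_linked_of_isAcyclic (hT : T.IsAcyclic) {r p q : W} (hp : T.Adj r p) (hq : T.Adj r q)
    (h : Linked T {r} p q) : p = q := by
  by_contra hne
  have hb := isAcyclic_iff_forall_adj_isBridge.1 hT hp
  rw [isBridge_iff, reachable_iff_linked_empty] at hb
  have h1 : Linked (T.deleteEdges {s(r, p)}) ∅ r q :=
    .of_adj (by simp [hq, Ne.symm hne, hp.ne]) id id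
  exact hb (h1.trans (linked_deleteEdges_of_linked_insert (by simpa using h.symm)))

/-- `g` identifies `G` with the graph obtained from `T` by replacing the stars centred at the
vertices of `Y` by cliques. -/
structure IsReplacement (T : SimpleGraph W) (Y : Set W) (G : SimpleGraph V) (g : V → W) :
    Prop where
  injective : Function.Injective g
  notMem : ∀ v, g v ∉ Y
  exists_eq : ∀ w, w ∉ Y → ∃ v, g v = w
  adj_iff : ∀ a b, G.Adj a b ↔ a ≠ b ∧ (T.Adj (g a) (g b) ∨
    ∃ y ∈ Y, T.Adj y (g a) ∧ T.Adj y (g b))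

lemma isReplacement_of_iso {Y : Set W} (f : G ≃g replaceByCliques T Y) :
    IsReplacement T Y G (fun v => (f v).1) where
  injective := Subtype.val_injective.comp f.injective
  notMem v := (f v).2
  exists_eq w hw := ⟨f.symm ⟨w, hw⟩, by simp⟩
  adj_iff a b := by
    rw [← f.map_adj_iff]
    change f a ≠ f b ∧ _ ↔ _
    rw [f.injective.ne_iff]

namespace IsReplacement

variable {Y : Set W} {g : V → W}

/-- A walk of `G` avoiding `v` gives a walk of `T` avoiding `g v`. -/
lemma linked (h : IsReplacement T Y G g) {v a b : V} (hl : Linked G {v} a b) :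
    Linked T {g v} (g a) (g b) := by
  refine hl.mem_of_closed (P := fun b => Linked T {g v} (g a) (g b)) (.refl ..) ?_
  intro p q hp hpq hpv hqv
  have hp' : g p ∉ ({g v} : Set W) := fun h' => hpv (h.injective h')
  have hq' : g q ∉ ({g v} : Set W) := fun h' => hqv (h.injective h')
  rcases ((h.adj_iff p q).1 hpq).2 with h1 | ⟨y, hy, h1, h2⟩
  · exact hp.trans (.of_adj h1 hp' hq')
  · have hyv : y ∉ ({g v} : Set W) := fun h' => h.notMem v (h' ▸ hy)
    exact (hp.trans (.of_adj h1.symm hp' hyv)).trans (.of_adj h2 hyv hq')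

lemma isBridge (h : IsReplacement T Y G g) (hT : T.IsAcyclic) {a b : V}
    (hab : T.Adj (g a) (g b)) : G.IsBridge s(a, b) := by
  have hb := isAcyclic_iff_forall_adj_isBridge.1 hT hab
  rw [isBridge_iff, reachable_iff_linked_empty] at hb ⊢
  intro hl
  refine hb (hl.mem_of_closed (P := fun b' =>
    Linked (T.deleteEdges {s(g a, g b)}) ∅ (g a) (g b')) (.refl ..) ?_)
  intro p q hp hpq _ _
  rw [deleteEdges_adj] at hpq
  rcases ((h.adj_iff p q).1 hpq.1).2 with h1 | ⟨y, hy, h1, h2⟩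
  · refine hp.trans (.of_adj ?_ id id)
    rw [deleteEdges_adj]
    refine ⟨h1, fun he => hpq.2 ?_⟩
    have he : s(g p, g q) = s(g a, g b) := he
    rw [Sym2.eq_iff] at he
    change s(p, q) = s(a, b)
    rw [Sym2.eq_iff]
    exact he.imp (fun h' => ⟨h.injective h'.1, h.injective h'.2⟩)
      (fun h' => ⟨h.injective h'.1, h.injective h'.2⟩)
  · have hne : ∀ c, y ≠ g c := fun c h' => h.notMem c (h' ▸ hy)
    have hstep : ∀ c, T.Adj y (g c) → (T.deleteEdges {s(g a, g b)}).Adj y (g c) := by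
      intro c hc
      simp [hc, hne]
    exact (hp.trans (.of_adj (hstep p h1).symm id id)).trans (.of_adj (hstep q h2) id id)

lemma modifiedDegree_le [Finite V] (h : IsReplacement T Y G g) (hconn : ∀ a b, Linked G ∅ a b)
    (v : V) [Fintype (T.neighborSet (g v))] : modifiedDegree G v ≤ T.degree (g v) := by
  classical
  obtain ⟨A, hA, hcard⟩ := exists_separated G {v}
  -- a neighbour of `v` in `G` arises from a neighbour of `g v` in `T`
  have hex : ∀ a : A, ∃ q w, Linked G {v} a q ∧ q ≠ v ∧ T.Adj (g v) w ∧
      (w = g q ∨ w ∈ Y ∧ T.Adj w (g q)) := by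
    rintro ⟨a, ha⟩
    obtain ⟨q, hq, -, hl⟩ := (hconn a v).exists_adj (hA.1 a ha)
    have hl : Linked G {v} a q := hl.mono le_rfl (by simp)
    rcases ((h.adj_iff q v).1 hq).2 with h1 | ⟨y, hy, h1, h2⟩
    · exact ⟨q, g q, hl, hq.ne, h1.symm, Or.inl rfl⟩
    · exact ⟨q, y, hl, hq.ne, h2.symm, Or.inr ⟨hy, h1⟩⟩
  choose q w hl hqv hw hqw using hex
  have hcardle := Fintype.card_le_of_injective
    (fun a => (⟨w a, hw a⟩ : T.neighborSet (g v))) (by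
      intro a b hab
      have hab : w a = w b := congrArg Subtype.val hab
      refine Subtype.ext (hA.2 a a.2 b b.2 (((hl a).trans ?_).trans (hl b).symm))
      by_cases hqq : q a = q b
      · exact .of_eq hqq
      have ha := hqw a
      have hb := hqw b
      rw [hab] at ha
      rcases ha with ha | ha <;> rcases hb with hb | hb
      · exact absurd (h.injective (ha.symm.trans hb)) hqq
      · exact absurd (ha ▸ hb.1) (h.notMem _)
      · exact absurd (hb ▸ ha.1) (h.notMem _)
      · exact .of_adj ((h.adj_iff _ _).2 ⟨hqq, Or.inr ⟨w b, ha.1, ha.2, hb.2⟩⟩) (hqv a) (hqv b))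
  rw [Fintype.card_coe, hcard, card_neighborSet_eq_degree] at hcardle
  exact hcardle

/-- Let `a`, `b`, `c` be the neighbours of `y ∈ Y`. The neighbours of `g c` in `T`, with `y`
counted once for `a` and once for `b`, give distinct components of `G - ab - c`. -/
lemma degree_add_one_le [Finite V] (h : IsReplacement T Y G g) (hT : T.IsAcyclic)
    (hind : T.IsIndepSet Y) (hY : ∀ y ∈ Y, ∀ r, ∃ x, T.Adj y x ∧ x ≠ r) {y : W} (hy : y ∈ Y)
    {a b c : V} (hab : a ≠ b) (hac : a ≠ c) (hbc : b ≠ c) (ha : T.Adj y (g a)) (hb : T.Adj y (g b))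
    (hc : T.Adj y (g c)) (honly : ∀ v, T.Adj y (g v) → v = a ∨ v = b ∨ v = c)
    [Fintype (T.neighborSet (g c))] :
    T.degree (g c) + 1 ≤ numComponents (G.deleteEdges {s(a, b)}) {c} := by
  classical
  have hex : ∀ w : T.neighborSet (g c), ∃ x : V, x ≠ c ∧ Linked T {g c} w (g x) ∧
      (w.1 = y → x = a) := by
    rintro ⟨w, hw⟩
    have hwc : w ∉ ({g c} : Set W) := hw.ne'
    by_cases hwy : w = y
    · exact ⟨a, hac, .of_adj (hwy ▸ ha) hwc fun h' => hac (h.injective h'), fun _ => rfl⟩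
    by_cases hwY : w ∈ Y
    · obtain ⟨x, hx, hxc⟩ := hY w hwY (g c)
      obtain ⟨v, rfl⟩ := h.exists_eq x fun hxY => hind hwY hxY hx.ne hx
      exact ⟨v, fun h' => hxc (congrArg g h'), .of_adj hx hwc hxc, fun h' => absurd h' hwy⟩
    · obtain ⟨v, rfl⟩ := h.exists_eq w hwY
      exact ⟨v, fun h' => hwc (congrArg g h'), .refl .., fun h' => absurd h' hwy⟩
  choose f hfc hfl hfa using hex
  let y' : T.neighborSet (g c) := ⟨y, hc.symm⟩
  have hinj : ∀ i j, Linked (G.deleteEdges {s(a, b)}) {c} (f i) (f j) → i = j := by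
    intro i j hij
    have := h.linked (hij.mono (deleteEdges_le _) subset_rfl)
    exact Subtype.ext (eq_of_linked_of_isAcyclic hT i.2 j.2
      (((hfl i).trans this).trans (hfl j).symm))
  -- without the edge `ab` and the vertex `c`, no walk of `G` uses the star centred at `y`
  have hnot : ¬ Linked (G.deleteEdges {s(a, b)}) {c} a b := by
    intro hl
    have hl' : Linked T {y} (g a) (g b) := by
      refine hl.mem_of_closed (P := fun x => Linked T {y} (g a) (g x)) (.refl ..) ?_
      intro p q hp hpq hpc hqc
      have hne : ∀ v, g v ∉ ({y} : Set W) := fun v h' => h.notMem v (h' ▸ hy)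
      rw [deleteEdges_adj] at hpq
      rcases ((h.adj_iff p q).1 hpq.1).2 with h1 | ⟨z, hz, h1, h2⟩
      · exact hp.trans (.of_adj h1 (hne p) (hne q))
      · by_cases hzy : z = y
        · subst hzy
          exfalso
          have hpc : p ≠ c := hpc
          have hqc : q ≠ c := hqc
          have hpq' : p ≠ q := hpq.1.ne
          have hpq2 : s(p, q) ≠ s(a, b) := hpq.2
          rw [Ne, Sym2.eq_iff] at hpq2
          have := honly p h1
          have := honly q h2
          grind
        · exact (hp.trans (.of_adj h1.symm (hne p) hzy)).trans (.of_adj h2 hzy (hne q))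
    exact hab (h.injective (eq_of_linked_of_isAcyclic hT ha hb hl'))
  have hb' : ∀ i, ¬ Linked (G.deleteEdges {s(a, b)}) {c} (f i) b := by
    intro i hl
    have h1 := h.linked (hl.mono (deleteEdges_le _) subset_rfl)
    have h2 : Linked T {g c} y (g b) :=
      .of_adj hb hc.ne fun h' => hbc (h.injective h')
    have hi : i = y' := Subtype.ext (eq_of_linked_of_isAcyclic hT i.2 hc.symm
      (((hfl i).trans h1).trans h2.symm))
    rw [hfa i (congrArg Subtype.val hi)] at hl
    exact hnot hl
  have := card_le_numComponents (G := G.deleteEdges {s(a, b)}) (S := {c})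
    (fun o : Option (T.neighborSet (g c)) => o.elim b f)
    (by rintro (- | i); exacts [hbc, hfc i])
    (by
      rintro (- | i) (- | j) hij
      · rfl
      · exact absurd hij.symm (hb' j)
      · exact absurd hij (hb' i)
      · exact congrArg some (hinj i j hij))
  rwa [Fintype.card_option, card_neighborSet_eq_degree] at this

end IsReplacement

/-- Deleting an edge of a triangle of a TT-graph adds a component to `G - c`, where `c` is the third
vertex of the triangle, and `c` has maximum modified degree. -/
lemma IsTTGraph.isMinimallyTough [Fintype V] (h : IsTTGraph G) (ht0 : 0 < t)
    (ht : toughness G = (t : EReal)) (hm : t = 1 / (maxModifiedDegree G : ℝ)) :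
    IsMinimallyTough G t := by
  classical
  refine ⟨ht, ?_⟩
  rcases h with h | ⟨W, _, T, _, Y, hT, -, ⟨hind, hY⟩, ⟨f⟩⟩
  · intro e he
    induction e with | h a b
    exact toughness_deleteEdges_lt_of_isBridge ht0
      (isAcyclic_iff_forall_adj_isBridge.1 h.isAcyclic he)
  have hr := isReplacement_of_iso f
  set g : V → W := fun v => (f v).1
  have hconn := linked_empty_of_isTough ht0 (isTough_of_toughness_eq ht)
  have hdeg3 : ∀ y ∈ Y, T.degree y = 3 := by
    rcases hY with ⟨-, rfl, -⟩ | ⟨-, h3, -⟩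
    · exact fun y hy => hy
    · exact h3
  have hmax : ∀ y ∈ Y, ∀ x, T.Adj y x → maxModifiedDegree G ≤ T.degree x := by
    intro y hy x hx
    refine Finset.sup_le fun v _ => (hr.modifiedDegree_le hconn v).trans ?_
    rcases hY with ⟨h3, hYeq, h2⟩ | ⟨-, -, h2⟩
    · rw [h2 y hy x hx]
      have h4 := T.degree_le_maxDegree (g v)
      have h5 : T.degree (g v) ≠ 3 := fun h' => hr.notMem v (by rw [hYeq]; exact h')
      omega
    · rw [h2 y hy x hx]
      exact T.degree_le_maxDegree _
  intro e he
  induction e with | h a b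
  have hab : G.Adj a b := he
  rcases ((hr.adj_iff a b).1 hab).2 with h1 | ⟨y, hy, ha, hb⟩
  · exact toughness_deleteEdges_lt_of_isBridge ht0 (hr.isBridge hT.isAcyclic h1)
  have hmem : ∀ {y x}, y ∈ Y → T.Adj y x → x ∉ Y := fun hy hx hxY => hind hy hxY hx.ne hx
  obtain ⟨c, hac, hbc, hc, honly⟩ : ∃ c, a ≠ c ∧ b ≠ c ∧ T.Adj y (g c) ∧
      ∀ v, T.Adj y (g v) → v = a ∨ v = b ∨ v = c := by
    have hcard : (((T.neighborFinset y).erase (g a)).erase (g b)).card = 1 := by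
      rw [Finset.card_erase_of_mem, Finset.card_erase_of_mem, card_neighborFinset_eq_degree,
        hdeg3 y hy]
      · simpa using ha
      · simp [hb, hr.injective.ne hab.ne']
    obtain ⟨x, hx⟩ := Finset.card_eq_one.1 hcard
    have hiff : ∀ z, (z ≠ g b ∧ z ≠ g a ∧ T.Adj y z) ↔ z = x := fun z => by
      rw [← Finset.mem_singleton, ← hx]; simp
    obtain ⟨hxb, hxa, hyx⟩ := (hiff x).2 rfl
    obtain ⟨c, rfl⟩ := hr.exists_eq x (hmem hy hyx)
    refine ⟨c, fun h' => hxa (congrArg g h'.symm), fun h' => hxb (congrArg g h'.symm), hyx, ?_⟩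
    intro v hv
    by_contra! hcon
    exact hcon.2.2 (hr.injective ((hiff (g v)).1
      ⟨hr.injective.ne hcon.2.1, hr.injective.ne hcon.1, hv⟩))
  have hother : ∀ y ∈ Y, ∀ r, ∃ x, T.Adj y x ∧ x ≠ r := by
    intro y hy r
    obtain ⟨x, hx, hxr⟩ := Finset.exists_mem_ne (s := T.neighborFinset y)
      (by rw [card_neighborFinset_eq_degree, hdeg3 y hy]; norm_num) r
    exact ⟨x, by simpa using hx, hxr⟩
  have h1 := hr.degree_add_one_le hT.isAcyclic hind hother hy hab.ne hac hbc ha hb hc honly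
  have h2 := hmax y hy (g c) hc
  set m := maxModifiedDegree G
  have hmpos : (0 : ℝ) < m := one_div_pos.1 (hm ▸ ht0)
  have hm1 : 1 ≤ m := by exact_mod_cast hmpos
  have h3 : ((m : ℝ) + 1) ≤ numComponents (G.deleteEdges {s(a, b)}) {c} := by
    exact_mod_cast (Nat.add_le_add_right h2 1).trans h1
  refine lt_of_le_of_lt (toughness_le_of_isCutset (S := {c}) (q := 1 / (m + 1)) ?_ ?_) ?_
  · unfold IsCutset; omega
  · rw [Set.ncard_singleton, Nat.cast_one, div_mul_eq_mul_div, one_mul, le_div_iff₀ (by positivity)]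
    linarith
  · rw [EReal.coe_lt_coe_iff, hm]
    exact one_div_lt_one_div_of_lt hmpos (by linarith)

end Converse

end ToughChordal

theorem theorem2 {V : Type u} [Fintype V] (G : SimpleGraph V)
    (hG : ToughChordal.IsChordal G) (t : ℚ) (ht0 : 0 < t) (ht : t ≤ 1 / 2) :
    ToughChordal.IsMinimallyTough G (t : ℝ) ↔
      ToughChordal.IsTTGraph G ∧
        ToughChordal.toughness G = ((t : ℝ) : EReal) ∧
          (t : ℝ) = 1 / (ToughChordal.maxModifiedDegree G : ℝ) := by
  have ht0' : (0 : ℝ) < t := by exact_mod_cast ht0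
  have ht' : (t : ℝ) ≤ 1 / 2 := by
    have := (Rat.cast_le (K := ℝ)).2 ht
    push_cast at this
    exact this
  constructor
  · intro h
    obtain ⟨htri, hm2, hm, hmax⟩ := h.isTriangleTree hG ht0' ht'
    have : Nonempty V := by
      by_contra hV
      rw [not_nonempty_iff] at hV
      have : ToughChordal.maxModifiedDegree G = 0 := by
        simp [ToughChordal.maxModifiedDegree]
      omega
    exact ⟨htri.isTTGraph hm2 hmax, h.1, hm⟩
  · rintro ⟨h, htough, hm⟩
    exact h.isMinimallyTough ht0' htough hm
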